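/- Let $M\in\mathbb{N}$, $M\ge 1$, and let $a=(a_1,\dots,a_M)$ and $b=(b_0,b_1,\dots,b_{M-1})$ have positive entries. For $L\ge 0$ and $c=(c_1,\dots,c_L)$ with positive entries let $$f_L(t\,|\,c)=t^L\prod_{j=1}^L(1-e^{-c_jt})^{-1}$$ (with the singularity at $t=0$ removed), $B_{L,m}(x\,|\,c)=\frac{d^m}{dt^m}\big|_{t=0}\bigl[f_L(t\,|\,c)e^{-xt}\bigr]$, and let the logarithm of the Barnes multiple gamma function be $$\log\Gamma_L(w\,|\,c)=\int_0^\infty\frac{dt}{t^{L+1}}\Bigl(e^{-wt}f_L(t\,|\,c)-\sum_{k=0}^{L-1}\frac{t^k}{k!}B_{L,k}(w\,|\,c)-\frac{t^Le^{-t}}{L!}B_{L,L}(w\,|\,c)\Bigr),\qquad \Re(w)>0,$$ continued holomorphically to $w\in\mathbb{C}\setminus(-\infty,0]$. For a function $h$ put $$(\mathcal{S}h)(q\,|\,b)=\sum_{p=0}^{M-1}(-1)^p\sum_{1\le k_1<\dots<k_p\le M-1}h(q+b_0+b_{k_1}+\dots+b_{k_p}),$$ and for $q\in\mathbb{C}\setminus(-\infty,-b_0]$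 let $$\eta(q\,|\,a,b)=\exp\bigl((\mathcal{S}\log\Gamma_M(\cdot\,|\,a))(q\,|\,b)-(\mathcal{S}\log\Gamma_M(\cdot\,|\,a))(0\,|\,b)\bigr).$$ Write $K(t)=e^{-b_0t}\,\prod_{j=1}^{M-1}(1-e^{-b_jt})\big/\prod_{i=1}^M(1-e^{-a_it})$, $\;r=\prod_{j=1}^{M-1}b_j\big/\prod_{i=1}^Ma_i$, and $\hat a_i$ for $a$ with the entry $a_i$ removed. Then: 1. There is exactly one probability distribution $\beta(a,b)$ on $(0,\infty)$ such that $\mathbf{E}[\beta(a,b)^q]$ exists and $\mathbf{E}[\beta(a,b)^q]=\eta(q\,|\,a,b)$ for all $q\in\mathbb{C}$ with $\Re(q)>-b_0$. 2. The law of $\log\beta(a,b)$ is infinitely divisible, absolutely continuous with respect to Lebesgue measure on $\mathbb{R}$, and has support equal to $\mathbb{R}$. For $\Re(q)>-b_0$ it has the Lévy–Khinchine decomposition $$\mathbf{E}\bigl[e^{q\log\beta(a,b)}\bigr]=\exp\Bigl(\int_0^\infty(e^{-tq}-1+qt)\,K(t)\,\frac{dt}{t}+q\int_0^\infty\Bigl[\frac{e^{-t}}{t}\,r-K(t)\Bigr]dt\Bigr),$$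 where both integrals converge absolutely. 3. For every $i=1,\dots,M$ and $q\in\mathbb{C}\setminus(-\infty,-b_0]$, $$\eta(q+a_i\,|\,a,b)=\eta(q\,|\,a,b)\,\exp\bigl(-(\mathcal{S}\log\Gamma_{M-1}(\cdot\,|\,\hat a_i))(q\,|\,b)\bigr).$$ 4. If $a_i=1$ for some $i$, then for every integer $k\ge 0$ the moment $\mathbf{E}[\beta(a,b)^k]$ is finite and $$\mathbf{E}[\beta(a,b)^k]=\exp\Bigl(-\sum_{l=0}^{k-1}(\mathcal{S}\log\Gamma_{M-1}(\cdot\,|\,\hat a_i))(l\,|\,b)\Bigr),$$ and for every integer $k\ge0$ with $k<b_0$ the moment $\mathbf{E}[\beta(a,b)^{-k}]$ is finite and $$\mathbf{E}[\beta(a,b)^{-k}]=\exp\Bigl(\sum_{l=0}^{k-1}(\mathcal{S}\log\Gamma_{M-1}(\cdot\,|\,\hat a_i))(-(l+1)\,|\,b)\Bigr).$$ 5. For every $\kappa>0$, $\;\beta(\kappa a,\kappa b)^\kappa=\kappa^{\,r}\,\beta(a,b)$ in law. -/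

import Mathlib

open MeasureTheory Set

noncomputable section

/-- `f_M(t | a) = t ^ M * ∏ j, (1 - exp (-a_j t))⁻¹`, with the removable singularity at `t = 0`
filled in by its limit `∏ j, 1 / a_j`. -/
def barnesF {M : ℕ} (a : Fin M → ℝ) (t : ℝ) : ℝ :=
  ∏ j, if t = 0 then (a j)⁻¹ else t / (1 - Real.exp (-(a j * t)))

/-- The multiple Bernoulli polynomial `B_{M,m}(x | a)`: the `m`-th derivative at `t = 0` of
`f_M(t | a) * exp (-x t)`. -/
def multipleBernoulli {M : ℕ} (m : ℕ) (a : Fin M → ℝ) (x : ℂ) : ℂ :=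
  iteratedDeriv m (fun t : ℝ => (barnesF a t : ℂ) * Complex.exp (-(x * t))) 0

/-- The Malmsten-type integral that defines `log Γ_M(w | a)` for `0 < re w`
(Ruijsenaars' normalization). -/
def malmstenLogGamma {M : ℕ} (a : Fin M → ℝ) (w : ℂ) : ℂ :=
  ∫ t in Ioi (0 : ℝ), ((t : ℂ) ^ (M + 1))⁻¹ *
    (Complex.exp (-(w * t)) * (barnesF a t : ℂ)
      - ∑ k ∈ Finset.range M, (t : ℂ) ^ k / (k.factorial : ℂ) * multipleBernoulli k a w
      - (t : ℂ) ^ M * Complex.exp (-(t : ℂ)) / (M.factorial : ℂ) * multipleBernoulli M a w)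

/-- `F` is the holomorphic continuation of the Malmsten-type integral from the right half-plane
to the plane cut along `(-∞, 0]`. -/
def IsLogBarnesGamma {M : ℕ} (a : Fin M → ℝ) (F : ℂ → ℂ) : Prop :=
  DifferentiableOn ℂ F Complex.slitPlane ∧ ∀ w : ℂ, 0 < w.re → F w = malmstenLogGamma a w

open Classical in
/-- The logarithm `log Γ_M(w | a)` of the Barnes multiple gamma function, holomorphic on the plane
cut along `(-∞, 0]`. It is given by the Malmsten-type integral for `0 < re w` and by its
(unique) holomorphic continuation elsewhere in the cut plane. -/
def logBarnesGamma {M : ℕ} (a : Fin M → ℝ) : ℂ → ℂ :=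
  if h : ∃ F, IsLogBarnesGamma a F then h.choose else malmstenLogGamma a

theorem logBarnesGamma_of_re_pos {M : ℕ} (a : Fin M → ℝ) {w : ℂ} (hw : 0 < w.re) :
    logBarnesGamma a w = malmstenLogGamma a w := by
  unfold logBarnesGamma
  split_ifs with h
  · exact h.choose_spec.2 w hw
  · rfl

/-- The holomorphic continuation to the cut plane is unique. -/
theorem IsLogBarnesGamma.eqOn {M : ℕ} {a : Fin M → ℝ} {F : ℂ → ℂ} (hF : IsLogBarnesGamma a F) :
    EqOn F (logBarnesGamma a) Complex.slitPlane := by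
  have h : ∃ F, IsLogBarnesGamma a F := ⟨F, hF⟩
  have hG : IsLogBarnesGamma a (logBarnesGamma a) := by
    unfold logBarnesGamma
    rw [dif_pos h]
    exact h.choose_spec
  have hconn : IsPreconnected Complex.slitPlane :=
    (Complex.starConvex_one_slitPlane.isPathConnected
      Complex.one_mem_slitPlane).isConnected.isPreconnected
  refine AnalyticOnNhd.eqOn_of_preconnected_of_eventuallyEq
    (hF.1.analyticOnNhd Complex.isOpen_slitPlane) (hG.1.analyticOnNhd Complex.isOpen_slitPlane)
    hconn Complex.one_mem_slitPlane ?_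
  have hopen : IsOpen {w : ℂ | 0 < w.re} := isOpen_lt continuous_const Complex.continuous_re
  filter_upwards [hopen.mem_nhds (show (1 : ℂ) ∈ {w : ℂ | 0 < w.re} by simp)] with w hw
  rw [hF.2 w hw, hG.2 w hw]

/-- The alternating sum `(S_N h)(q | b)` over all sub-collections of `b_1, …, b_N`,
for `b = (b_0, b_1, …, b_N)`. -/
def alternatingShift {N : ℕ} (h : ℂ → ℂ) (b : Fin (N + 1) → ℝ) (q : ℂ) : ℂ :=
  ∑ s : Finset (Fin N), (-1) ^ s.card * h (q + b 0 + ∑ j ∈ s, (b j.succ : ℂ))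

/-- The intertwining ratio `η_{M,N}(q | a, b)` of Barnes multiple gamma functions. -/
def barnesEta {M N : ℕ} (a : Fin M → ℝ) (b : Fin (N + 1) → ℝ) (q : ℂ) : ℂ :=
  Complex.exp (alternatingShift (logBarnesGamma a) b q - alternatingShift (logBarnesGamma a) b 0)

/-- `β` is a probability distribution on `(0, ∞)` whose Mellin transform `E[β ^ q]` exists and
equals `η q` for all complex `q` with `σ < re q`. -/
structure HasMellinTransform (β : Measure ℝ) (σ : ℝ) (η : ℂ → ℂ) : Prop where
  isProbabilityMeasure : IsProbabilityMeasure β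
  measure_Iic_zero : β (Iic 0) = 0
  integrable : ∀ q : ℂ, σ < q.re → Integrable (fun x : ℝ => (x : ℂ) ^ q) β
  integral_eq : ∀ q : ℂ, σ < q.re → ∫ x : ℝ, (x : ℂ) ^ q ∂β = η q

/-- A distribution `μ` on `ℝ` is infinitely divisible: for every `n ≥ 1` it is the law of a sum of
`n` independent random variables with a common law `ν`. -/
def IsInfinitelyDivisible (μ : Measure ℝ) : Prop :=
  ∀ n : ℕ, 1 ≤ n → ∃ ν : Measure ℝ, IsProbabilityMeasure ν ∧
    (Measure.pi fun _ : Fin n => ν).map (fun x => ∑ i, x i) = μ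

/-- `e^{-b_0 t} ∏_{j=1}^{N} (1 - e^{-b_j t}) / ∏_{i=1}^{M} (1 - e^{-a_i t})`. -/
def levyKernel {M N : ℕ} (a : Fin M → ℝ) (b : Fin (N + 1) → ℝ) (t : ℝ) : ℝ :=
  Real.exp (-(b 0 * t)) * (∏ j : Fin N, (1 - Real.exp (-(b j.succ * t)))) /
    ∏ i, (1 - Real.exp (-(a i * t)))

/-- `∏_{j=1}^{N} b_j / ∏_{i=1}^{M} a_i`. -/
def barnesRatio {M N : ℕ} (a : Fin M → ℝ) (b : Fin (N + 1) → ℝ) : ℝ :=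
  (∏ j : Fin N, b j.succ) / ∏ i, a i

/-- The integrand `(e^{-tq} - 1 + qt) K(t) / t` of the jump part of the exponent. -/
def levyJumpIntegrand {M N : ℕ} (a : Fin M → ℝ) (b : Fin (N + 1) → ℝ) (q : ℂ) (t : ℝ) : ℂ :=
  (Complex.exp (-(t * q)) - 1 + q * t) * (levyKernel a b t : ℂ) / t

/-- The integrand `(e^{-t} / t) ∏ b_j / ∏ a_i - K(t)` of the drift. -/
def levyDriftIntegrand {M N : ℕ} (a : Fin M → ℝ) (b : Fin (N + 1) → ℝ) (t : ℝ) : ℝ :=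
  Real.exp (-t) / t * barnesRatio a b - levyKernel a b t

end

/-! ### Holomorphy of integrals depending on a complex parameter. -/

section ParametricIntegral

open Metric Filter Topology

/-! Write `M = N + 1`. Applying the alternating shift to `e^{-wt}` gives `e^{-qt}` times the
numerator of `K`, by inclusion–exclusion. Multiplied by `f_M`, this is `t^N e^{-qt}` times the
smooth function `t K(t)`, so in the difference between `q` and `0` all Bernoulli terms of degree at
most `N` cancel and the top one contributes only `q r e^{-t}`. Hence `log η(q) = ∫ ((e^{-qt} - 1)
K(t) + q r e^{-t}) dt/t`, and adding and subtracting `q t K(t)` puts it in Lévy–Khinchine form with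
jump density `K(t)/t ≥ 0` (`alternatingShift_malmstenIntegrand_sub`, `barnesEta_eq_exp`).

A law with this exponent is a limit of translated compound Poisson laws with jumps larger than `ε`.
The limit of their characteristic functions is continuous at `0`, so they are tight; exponential
moments pass to the limit by a Fatou argument; the identity theorem carries the formula from the
imaginary axis to the half-plane (`exists_hasExpTransform_of_tendsto`,
`exists_hasExpTransform_levy`). Dividing the exponent by `n` gives convolution roots, hence infinite
divisibility. The Mellin transform on the imaginary axis is the characteristic function of the
logarithm, so the law is unique.

Near `0` the jump density is comparable to `t^{-2}`, so the characteristic function of the logarithm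
is `O(e^{-c|u|})`. Fourier inversion then yields a density that extends holomorphically to a strip.
It gives absolute continuity, and full support because a density vanishing on an interval would
vanish identically.

The functional equation comes from `f_M(t | a) (1 - e^{-a_i t}) = t f_{M-1}(t | â_i)`, which turns a
shift by `a_i` into a drop in rank. The same relation, used inductively from `log Γ_0(w) = -log w`,
constructs the continuation to the cut plane. Moments telescope the functional equation, and scaling
is a change of variables whose correction is a Frullani integral. -/

/-- An integral depending on a complex parameter is holomorphic if the integrand is holomorphic and
locally uniformly dominated. -/
theorem differentiableOn_integral_of_locally_dominated {α : Type*} [MeasurableSpace α]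
    {μ : Measure α} {U : Set ℂ} (hU : IsOpen U) {F : ℂ → α → ℂ}
    (hmeas : ∀ q ∈ U, AEStronglyMeasurable (F q) μ)
    (hdiff : ∀ᵐ t ∂μ, DifferentiableOn ℂ (fun q => F q t) U)
    (hbound : ∀ q₀ ∈ U, ∃ r > 0, ∃ g : α → ℝ, Integrable g μ ∧
      ∀ᵐ t ∂μ, ∀ q ∈ ball q₀ r, ‖F q t‖ ≤ g t) :
    DifferentiableOn ℂ (fun q => ∫ t, F q t ∂μ) U := by
  intro q₀ hq₀
  obtain ⟨r₁, hr₁, g, hg, hgb⟩ := hbound q₀ hq₀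
  obtain ⟨r₂, hr₂, hr₂U⟩ := Metric.isOpen_iff.1 hU q₀ hq₀
  set r := min r₁ r₂ with hr
  have hr0 : 0 < r := lt_min hr₁ hr₂
  have hsub : ball q₀ r ⊆ U := (ball_subset_ball (min_le_right _ _)).trans hr₂U
  have hder : ∀ᵐ t ∂μ, ∀ q ∈ U, HasDerivAt (fun q => F q t) (deriv (fun q => F q t) q) q := by
    filter_upwards [hdiff] with t ht q hq
    exact (ht.differentiableAt (hU.mem_nhds hq)).hasDerivAt
  -- The derivative is measurable as a limit of difference quotients along a sequence tending to
  -- `q₀`; the denominator `n + 2` keeps the whole sequence inside the ball of radius `r`.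
  have hF'meas : AEStronglyMeasurable (fun t => deriv (fun q => F q t) q₀) μ := by
    let h : ℕ → ℂ := fun n => q₀ + (r / (n + 2) : ℝ)
    have hhU : ∀ n, h n ∈ U := fun n => hsub (by
      have h2 : (0 : ℝ) < n + 2 := by positivity
      have : r / (n + 2) < r := by
        rw [div_lt_iff₀ h2]; nlinarith [(Nat.cast_nonneg n : (0 : ℝ) ≤ n)]
      simp only [h, mem_ball, dist_self_add_left, Complex.norm_real, Real.norm_eq_abs]
      rwa [abs_of_pos (by positivity)])
    have hlim : Tendsto h atTop (𝓝[≠] q₀) := by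
      rw [tendsto_nhdsWithin_iff]
      constructor
      · have h1 : Tendsto (fun n : ℕ => r / ((n : ℝ) + 2)) atTop (𝓝 0) :=
          tendsto_const_nhds.div_atTop
            (tendsto_atTop_add_const_right _ _ tendsto_natCast_atTop_atTop)
        have h2 : Tendsto (fun n : ℕ => ((r / ((n : ℝ) + 2) : ℝ) : ℂ)) atTop (𝓝 0) := by
          simpa [Function.comp_def] using (Complex.continuous_ofReal.tendsto 0).comp h1
        simpa [h] using h2.const_add q₀
      · refine Eventually.of_forall fun n => ?_
        have h2 : (0 : ℝ) < n + 2 := by positivity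
        have : (r / (n + 2) : ℝ) ≠ 0 := by positivity
        simp only [h, mem_compl_iff, mem_singleton_iff, add_eq_left]
        exact_mod_cast this
    refine aestronglyMeasurable_of_tendsto_ae atTop
      (f := fun n t => slope (fun q => F q t) q₀ (h n)) (fun n => ?_) ?_
    · simp only [slope_def_field]
      exact ((hmeas _ (hhU n)).sub (hmeas _ hq₀)).mul_const (h n - q₀)⁻¹
    · filter_upwards [hder] with t ht
      exact (hasDerivAt_iff_tendsto_slope.1 (ht q₀ hq₀)).comp hlim
  refine (hasDerivAt_integral_of_dominated_loc_of_deriv_le (μ := μ) (F := F)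
    (F' := fun q t => deriv (fun q => F q t) q) (x₀ := q₀)
    (bound := fun t => g t / (r / 2)) (s := ball q₀ (r / 2)) (ball_mem_nhds _ (by positivity))
    ?_ ?_ hF'meas ?_ (hg.div_const _) ?_).2.differentiableAt.differentiableWithinAt
  · filter_upwards [hU.mem_nhds hq₀] with q hq using hmeas q hq
  · refine hg.mono' (hmeas _ hq₀) ?_
    filter_upwards [hgb] with t ht using ht q₀ (mem_ball_self hr₁)
  · filter_upwards [hgb, hdiff] with t ht hd q hq
    -- Cauchy's estimate on circles of radius `r / 2` turns the bound `g` on the integrand into the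
    -- bound `g / (r / 2)` on its derivative.
    have hcb : closedBall q (r / 2) ⊆ ball q₀ r := fun z hz => by
      have h1 := mem_closedBall.1 hz
      have h2 := mem_ball.1 hq
      have h3 := dist_triangle z q q₀
      exact mem_ball.2 (by linarith)
    refine Complex.norm_deriv_le_of_forall_mem_sphere_norm_le (by positivity) ?_ fun z hz => ?_
    · exact (hd.mono (hcb.trans hsub)).diffContOnCl_ball subset_rfl
    · exact ht z (ball_subset_ball (min_le_left _ _) (hcb (sphere_subset_closedBall hz)))
  · filter_upwards [hder] with t ht q hq
    exact ht q (hsub (ball_subset_ball (by linarith) hq))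

end ParametricIntegral

/-! ### Iterated derivatives at zero and Taylor remainders. -/

section IteratedDeriv

theorem iteratedDeriv_id_mul_zero {g : ℝ → ℂ} (k : ℕ) (hg : ContDiffAt ℝ k g 0) :
    iteratedDeriv k (fun t : ℝ => (t : ℂ) * g t) 0 = k * iteratedDeriv (k - 1) g 0 := by
  have h := iteratedDerivWithin_smul (n := k) (s := univ) (x := (0 : ℝ))
    (f := fun t : ℝ => t) (g := g) (mem_univ _) uniqueDiffOn_univ contDiffAt_id.contDiffWithinAt
    hg.contDiffWithinAt
  simp only [iteratedDerivWithin_univ] at h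
  have e : (fun t : ℝ => (t : ℂ) * g t) = (fun t : ℝ => t) • g := by
    funext t; simp
  rw [e, h]
  rcases k with _ | k
  · simp
  rw [Finset.sum_eq_single 1]
  · simp [iteratedDeriv_fun_id_zero]
  · intro i _ hi
    simp [iteratedDeriv_fun_id_zero, hi]
  · intro h; simp at h

/-- Measures the effect of a zero of order `n`. For `k < n` the descending factorial vanishes, so
the truncated subtraction `k - n` does no harm. -/
theorem iteratedDeriv_pow_mul_zero (n : ℕ) : ∀ (k : ℕ) {g : ℝ → ℂ}, ContDiffAt ℝ k g 0 →
    iteratedDeriv k (fun t : ℝ => (t : ℂ) ^ n * g t) 0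
      = k.descFactorial n * iteratedDeriv (k - n) g 0 := by
  induction n with
  | zero => intro k g _; simp
  | succ n ih =>
    intro k g hg
    have e : (fun t : ℝ => (t : ℂ) ^ (n + 1) * g t)
        = fun t : ℝ => (t : ℂ) * ((t : ℂ) ^ n * g t) := by
      funext t; ring
    have hp : ContDiffAt ℝ k (fun t : ℝ => (t : ℂ) ^ n * g t) 0 :=
      (Complex.ofRealCLM.contDiff.pow n).contDiffAt.mul hg
    rw [e, iteratedDeriv_id_mul_zero k hp,
      ih (k - 1) (hg.of_le (by exact_mod_cast Nat.sub_le k 1))]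
    rcases k with _ | k
    · simp
    · simp only [Nat.add_sub_cancel, Nat.succ_descFactorial_succ, Nat.add_sub_add_right]
      push_cast; ring

theorem iteratedDeriv_cexp_neg_mul_zero (w : ℂ) (m : ℕ) :
    iteratedDeriv m (fun t : ℝ => Complex.exp (-(w * t))) 0 = (-w) ^ m := by
  have h : ∀ m, iteratedDeriv m (fun t : ℝ => Complex.exp (-(w * t)))
      = fun t : ℝ => (-w) ^ m * Complex.exp (-(w * t)) := by
    intro m
    induction m with
    | zero => simp
    | succ m ih =>
      rw [iteratedDeriv_succ, ih]
      funext t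
      have h1 : HasDerivAt (fun t : ℝ => Complex.exp (-(w * t)))
          (Complex.exp (-(w * t)) * (-(w * 1))) t :=
        ((Complex.ofRealCLM.hasDerivAt (x := t)).const_mul w).neg.cexp
      rw [(h1.const_mul _).deriv]
      ring
  rw [h]; simp

/-- Taylor expansion at `0`, on the right. -/
theorem exists_taylor_bound_zero {f : ℝ → ℂ} (n : ℕ) (hf : ContDiff ℝ (n + 1) f) :
    ∃ C, ∀ t ∈ Icc (0 : ℝ) 1,
      ‖f t - ∑ k ∈ Finset.range (n + 1), (t : ℂ) ^ k / k.factorial * iteratedDeriv k f 0‖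
        ≤ C * t ^ (n + 1) := by
  obtain ⟨C, hC⟩ := exists_taylor_mean_remainder_bound (f := f) (n := n) zero_le_one hf.contDiffOn
  refine ⟨C, fun t ht => ?_⟩
  have := hC t ht
  rw [taylor_within_apply, sub_zero] at this
  refine le_of_eq_of_le ?_ this
  congr 2
  refine Finset.sum_congr rfl fun k hk => ?_
  rw [iteratedDerivWithin_eq_iteratedDeriv (uniqueDiffOn_Icc zero_lt_one) _
    (left_mem_Icc.2 zero_le_one)]
  · rw [Complex.real_smul]; push_cast; ring
  · refine hf.contDiffAt.of_le ?_
    have := Finset.mem_range.1 hk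
    exact_mod_cast this.le

end IteratedDeriv

/-! ### The function `f_L`: analyticity, positivity and growth. -/

section BarnesF

theorem one_sub_exp_neg_pos {x : ℝ} (hx : 0 < x) : 0 < 1 - Real.exp (-x) := by
  have := Real.exp_lt_exp.2 (neg_lt_zero.2 hx)
  rw [Real.exp_zero] at this
  linarith

theorem one_sub_exp_neg_le (x : ℝ) : 1 - Real.exp (-x) ≤ x := by
  linarith [Real.add_one_le_exp (-x)]

/-- A rearrangement of `1 + x ≤ e^x`, from which `t / (1 - e^{-ct}) ≤ t + 1/c` follows. -/
theorem le_one_add_mul_one_sub_exp_neg (x : ℝ) :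
    x ≤ (1 + x) * (1 - Real.exp (-x)) := by
  have h1 : (x + 1) * Real.exp (-x) ≤ Real.exp x * Real.exp (-x) :=
    mul_le_mul_of_nonneg_right (Real.add_one_le_exp x) (Real.exp_pos _).le
  rw [← Real.exp_add, add_neg_cancel, Real.exp_zero] at h1
  linarith

/-- The factor `t / (1 - exp (-c t))` of `barnesF`, with the singularity removed. -/
noncomputable def barnesFactor (c t : ℝ) : ℝ :=
  if t = 0 then c⁻¹ else t / (1 - Real.exp (-(c * t)))

theorem barnesF_eq_prod {M : ℕ} (a : Fin M → ℝ) (t : ℝ) :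
    barnesF a t = ∏ j, barnesFactor (a j) t := rfl

/-- The divided slope of an analytic function is analytic and here does not vanish at `0`, so the
singularity of the factor is removable. -/
theorem barnesFactor_eq_dslope (c : ℝ) :
    barnesFactor c = fun t => (dslope (fun t : ℝ => 1 - Real.exp (-(c * t))) 0 t)⁻¹ := by
  funext t
  unfold barnesFactor
  split_ifs with h
  · subst h
    have h1 : HasDerivAt (fun t : ℝ => 1 - Real.exp (-(c * t)))
        (-(Real.exp (-(c * 0)) * (-(c * 1)))) 0 :=
      ((((hasDerivAt_id (0 : ℝ)).const_mul c).neg).exp).const_sub 1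
    rw [dslope_same, h1.deriv]
    simp
  · rw [dslope_of_ne _ h, slope_def_field]
    simp

theorem one_sub_exp_neg_ne_zero {x : ℝ} (hx : x ≠ 0) : 1 - Real.exp (-x) ≠ 0 := by
  rw [sub_ne_zero]
  intro h
  exact hx (by simpa using (Real.exp_eq_one_iff (-x)).1 h.symm)

theorem analyticAt_barnesFactor {c : ℝ} (hc : 0 < c) (x : ℝ) : AnalyticAt ℝ (barnesFactor c) x := by
  have han : ∀ y, AnalyticAt ℝ (fun t : ℝ => 1 - Real.exp (-(c * t))) y := fun y => by fun_prop
  by_cases hx : x = 0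
  · subst hx
    have h1 : AnalyticAt ℝ (dslope (fun t : ℝ => 1 - Real.exp (-(c * t))) 0) 0 := by
      obtain ⟨p, hp⟩ := han 0
      exact ⟨_, hp.has_fpower_series_dslope_fslope⟩
    rw [barnesFactor_eq_dslope]
    refine h1.inv ?_
    have := congrFun (barnesFactor_eq_dslope c) 0
    simp only [barnesFactor, if_true] at this
    intro h0
    rw [h0, inv_zero] at this
    exact (inv_pos.2 hc).ne' this
  · have h1 : AnalyticAt ℝ (fun t : ℝ => t / (1 - Real.exp (-(c * t)))) x :=
      analyticAt_id.div (han x) (one_sub_exp_neg_ne_zero (mul_ne_zero hc.ne' hx))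
    refine h1.congr ?_
    filter_upwards [isOpen_ne.mem_nhds hx] with t ht
    have ht : t ≠ 0 := ht
    simp [barnesFactor, ht]

theorem barnesFactor_of_ne {c t : ℝ} (ht : t ≠ 0) :
    barnesFactor c t = t / (1 - Real.exp (-(c * t))) := by
  simp [barnesFactor, ht]

theorem barnesFactor_mul {c : ℝ} (hc : 0 < c) (t : ℝ) :
    barnesFactor c t * (1 - Real.exp (-(c * t))) = t := by
  by_cases ht : t = 0
  · simp [ht]
  · rw [barnesFactor_of_ne ht,
      div_mul_cancel₀ _ (one_sub_exp_neg_ne_zero (mul_ne_zero hc.ne' ht))]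

theorem barnesFactor_pos {c t : ℝ} (hc : 0 < c) (ht : 0 ≤ t) : 0 < barnesFactor c t := by
  rcases ht.eq_or_lt with rfl | ht
  · simpa [barnesFactor] using hc
  · rw [barnesFactor_of_ne ht.ne']
    exact div_pos ht (one_sub_exp_neg_pos (by positivity))

theorem barnesFactor_le {c t : ℝ} (hc : 0 < c) (ht : 0 ≤ t) : barnesFactor c t ≤ t + c⁻¹ := by
  rcases ht.eq_or_lt with rfl | ht
  · simp [barnesFactor]
  · rw [barnesFactor_of_ne ht.ne', div_le_iff₀ (one_sub_exp_neg_pos (by positivity))]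
    have h := le_one_add_mul_one_sub_exp_neg (c * t)
    have e : t + c⁻¹ = c⁻¹ * (1 + c * t) := by field_simp; ring
    rw [e, mul_assoc]
    calc t = c⁻¹ * (c * t) := by field_simp
      _ ≤ _ := mul_le_mul_of_nonneg_left h (inv_pos.2 hc).le

variable {M : ℕ} {a : Fin M → ℝ}

theorem analyticAt_barnesF (ha : ∀ i, 0 < a i) (x : ℝ) : AnalyticAt ℝ (barnesF a) x := by
  have : barnesF a = fun t => ∏ j, barnesFactor (a j) t := rfl
  rw [this]
  exact Finset.analyticAt_fun_prod _ fun j _ => analyticAt_barnesFactor (ha j) x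

theorem contDiff_barnesF (ha : ∀ i, 0 < a i) (n : WithTop ℕ∞) : ContDiff ℝ n (barnesF a) :=
  contDiff_iff_contDiffAt.2 fun x => (analyticAt_barnesF ha x).contDiffAt

theorem contDiff_ofReal_barnesF (ha : ∀ i, 0 < a i) (n : WithTop ℕ∞) :
    ContDiff ℝ n (fun t => (barnesF a t : ℂ)) :=
  Complex.ofRealCLM.contDiff.comp (contDiff_barnesF ha n)

theorem contDiff_cexp_neg_mul (w : ℂ) (n : WithTop ℕ∞) :
    ContDiff ℝ n (fun t : ℝ => Complex.exp (-(w * t))) :=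
  (contDiff_const.mul Complex.ofRealCLM.contDiff).neg.cexp

theorem continuous_barnesF (ha : ∀ i, 0 < a i) : Continuous (barnesF a) :=
  (contDiff_barnesF ha 0).continuous

theorem barnesF_pos (ha : ∀ i, 0 < a i) {t : ℝ} (ht : 0 ≤ t) : 0 < barnesF a t :=
  Finset.prod_pos fun j _ => barnesFactor_pos (ha j) ht

theorem barnesF_le (ha : ∀ i, 0 < a i) {t : ℝ} (ht : 0 ≤ t) :
    barnesF a t ≤ ∏ j, (t + (a j)⁻¹) :=
  Finset.prod_le_prod (fun j _ => (barnesFactor_pos (ha j) ht).le)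
    fun j _ => barnesFactor_le (ha j) ht

theorem barnesF_le_pow (ha : ∀ i, 0 < a i) {t : ℝ} (ht : 1 ≤ t) :
    barnesF a t ≤ t ^ M * ∏ j, (1 + (a j)⁻¹) := by
  refine (barnesF_le ha (by linarith)).trans ?_
  rw [← Fin.prod_const, ← Finset.prod_mul_distrib]
  refine Finset.prod_le_prod (fun j _ => ?_) fun j _ => ?_
  · have := inv_pos.2 (ha j); linarith
  · have := inv_pos.2 (ha j); nlinarith

/-- The cancellation behind all shift formulas: a shift by `a i` produces the factor that removes
the `i`-th denominator, at the price of one power of `t`. -/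
theorem barnesF_mul_one_sub_exp {N : ℕ} {a : Fin (N + 1) → ℝ} (ha : ∀ i, 0 < a i)
    (i : Fin (N + 1)) (t : ℝ) :
    barnesF a t * (1 - Real.exp (-(a i * t))) = t * barnesF (i.removeNth a) t := by
  rw [barnesF_eq_prod, barnesF_eq_prod, Fin.prod_univ_succAbove _ i, mul_right_comm,
    barnesFactor_mul (ha i)]
  rfl

end BarnesF

/-! ### Multiple Bernoulli polynomials. -/

section MultipleBernoulli

variable {M : ℕ} {a : Fin M → ℝ}

theorem multipleBernoulli_eq_sum (ha : ∀ i, 0 < a i) (m : ℕ) (w : ℂ) :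
    multipleBernoulli m a w = ∑ i ∈ Finset.range (m + 1),
      m.choose i * iteratedDeriv i (fun t => (barnesF a t : ℂ)) 0 * (-w) ^ (m - i) := by
  unfold multipleBernoulli
  rw [iteratedDeriv_fun_mul (contDiff_ofReal_barnesF ha _).contDiffAt
    (contDiff_cexp_neg_mul w _).contDiffAt]
  simp only [iteratedDeriv_cexp_neg_mul_zero]

theorem exists_multipleBernoulli_bound (ha : ∀ i, 0 < a i) (m : ℕ) (R : ℝ) :
    ∃ C, 0 ≤ C ∧ ∀ w : ℂ, ‖w‖ ≤ R → ‖multipleBernoulli m a w‖ ≤ C := by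
  have hc : Continuous (multipleBernoulli m a) := by
    have : multipleBernoulli m a = fun w => ∑ i ∈ Finset.range (m + 1),
      m.choose i * iteratedDeriv i (fun t => (barnesF a t : ℂ)) 0 * (-w) ^ (m - i) :=
      funext (multipleBernoulli_eq_sum ha m)
    rw [this]; fun_prop
  obtain ⟨C, hC⟩ := (isCompact_closedBall (0 : ℂ) R).exists_bound_of_continuousOn hc.continuousOn
  exact ⟨max C 0, le_max_right _ _, fun w hw =>
    (hC w (by simpa using hw)).trans (le_max_left _ _)⟩

theorem differentiable_multipleBernoulli (ha : ∀ i, 0 < a i) (m : ℕ) :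
    Differentiable ℂ (multipleBernoulli m a) := by
  have : multipleBernoulli m a = fun w => ∑ i ∈ Finset.range (m + 1),
      m.choose i * iteratedDeriv i (fun t => (barnesF a t : ℂ)) 0 * (-w) ^ (m - i) :=
    funext (multipleBernoulli_eq_sum ha m)
  rw [this]; fun_prop

/-- Obtained by differentiating `barnesF_mul_one_sub_exp` times `e^{-wt}` at `0`. At `k = 0` the
truncated `k - 1` is multiplied by zero. -/
theorem multipleBernoulli_add {N : ℕ} {a : Fin (N + 1) → ℝ} (ha : ∀ i, 0 < a i)
    (i : Fin (N + 1)) (k : ℕ) (w : ℂ) :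
    multipleBernoulli k a (w + a i)
      = multipleBernoulli k a w - k * multipleBernoulli (k - 1) (i.removeNth a) w := by
  have ha' : ∀ j, 0 < i.removeNth a j := fun j => ha _
  have hG : ∀ n : WithTop ℕ∞, ContDiff ℝ n
      (fun t : ℝ => (barnesF (i.removeNth a) t : ℂ) * Complex.exp (-(w * t))) := fun n =>
    (contDiff_ofReal_barnesF ha' n).mul (contDiff_cexp_neg_mul w n)
  have hid : ContDiff ℝ k (fun t : ℝ => (t : ℂ)) := Complex.ofRealCLM.contDiff
  unfold multipleBernoulli
  rw [← iteratedDeriv_id_mul_zero k (hG _).contDiffAt, ← iteratedDeriv_fun_sub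
    ((contDiff_ofReal_barnesF ha _).mul (contDiff_cexp_neg_mul w _)).contDiffAt
    (hid.mul (hG _)).contDiffAt]
  congr 1
  funext t
  have h := congrArg (fun x : ℝ => (x : ℂ)) (barnesF_mul_one_sub_exp ha i t)
  push_cast at h
  have e : Complex.exp (-((w + a i) * t)) = Complex.exp (-(w * t)) * Complex.exp (-(a i * t)) := by
    rw [← Complex.exp_add]; congr 1; ring
  rw [e]
  linear_combination (-Complex.exp (-(w * t))) * h

end MultipleBernoulli

/-! ### The Malmsten integral: convergence, holomorphy and shift. -/

section Malmsten

variable {M : ℕ} {a : Fin M → ℝ}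

/-- The integrand of `malmstenLogGamma`. -/
noncomputable def malmstenIntegrand (a : Fin M → ℝ) (w : ℂ) (t : ℝ) : ℂ :=
  ((t : ℂ) ^ (M + 1))⁻¹ *
    (Complex.exp (-(w * t)) * (barnesF a t : ℂ)
      - ∑ k ∈ Finset.range M, (t : ℂ) ^ k / (k.factorial : ℂ) * multipleBernoulli k a w
      - (t : ℂ) ^ M * Complex.exp (-(t : ℂ)) / (M.factorial : ℂ) * multipleBernoulli M a w)

theorem malmstenLogGamma_eq_integral (a : Fin M → ℝ) (w : ℂ) :
    malmstenLogGamma a w = ∫ t in Ioi (0 : ℝ), malmstenIntegrand a w t := rfl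

theorem integrableOn_Ioi_zero_ite {g₁ g₂ : ℝ → ℝ} (h₁ : IntegrableOn g₁ (Ioc 0 1))
    (h₂ : IntegrableOn g₂ (Ioi 1)) :
    IntegrableOn (fun t => if t ≤ 1 then g₁ t else g₂ t) (Ioi 0) := by
  rw [← Ioc_union_Ioi_eq_Ioi (zero_le_one (α := ℝ))]
  refine IntegrableOn.union ?_ ?_
  · refine h₁.congr_fun (fun t ht => ?_) measurableSet_Ioc
    simp [ht.2]
  · refine h₂.congr_fun (fun t ht => ?_) measurableSet_Ioi
    have : ¬ t ≤ 1 := not_le.2 ht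
    simp [this]

/-- Separates the Taylor polynomial of the product into that of `f` and those of the exponential, so
that the remainder near `0` can be bounded uniformly for bounded `w`. -/
theorem sum_multipleBernoulli_eq (ha : ∀ i, 0 < a i) (n : ℕ) (w : ℂ) (t : ℝ) :
    ∑ k ∈ Finset.range n, (t : ℂ) ^ k / (k.factorial : ℂ) * multipleBernoulli k a w
      = ∑ j ∈ Finset.range n,
        (t : ℂ) ^ j / j.factorial * iteratedDeriv j (fun t => (barnesF a t : ℂ)) 0 *
          ∑ i ∈ Finset.range (n - j), (-(w * t)) ^ i / i.factorial := by
  simp_rw [multipleBernoulli_eq_sum ha, Finset.mul_sum]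
  rw [← Finset.sum_range_diag_flip n fun j i =>
    (t : ℂ) ^ j / j.factorial * iteratedDeriv j (fun t => (barnesF a t : ℂ)) 0 *
          ((-(w * t)) ^ i / i.factorial)]
  refine Finset.sum_congr rfl fun k _ => Finset.sum_congr rfl fun i hi => ?_
  have hik : i ≤ k := Nat.lt_succ_iff.1 (Finset.mem_range.1 hi)
  have hf : (k.choose i : ℂ) = k.factorial / (i.factorial * (k - i).factorial) :=
    Nat.cast_choose ℂ hik
  have h1 : (k.factorial : ℂ) ≠ 0 := by exact_mod_cast k.factorial_ne_zero
  have h2 : (i.factorial : ℂ) ≠ 0 := by exact_mod_cast i.factorial_ne_zero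
  have h3 : ((k - i).factorial : ℂ) ≠ 0 := by exact_mod_cast (k - i).factorial_ne_zero
  have h4 : (t : ℂ) ^ k = (t : ℂ) ^ i * (t : ℂ) ^ (k - i) := by
    rw [← pow_add, Nat.add_sub_cancel' hik]
  have h5 : (-(w * (t : ℂ))) ^ (k - i) = (-w) ^ (k - i) * (t : ℂ) ^ (k - i) := by
    rw [← neg_mul, mul_pow]
  rw [hf, h4, h5]
  field_simp

theorem exists_malmstenIntegrand_bound_Ioc (ha : ∀ i, 0 < a i) (R : ℝ) :
    ∃ C, ∀ w : ℂ, ‖w‖ ≤ R → ∀ t ∈ Ioc (0 : ℝ) 1, ‖malmstenIntegrand a w t‖ ≤ C := by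
  obtain ⟨C₀, hC₀⟩ := exists_taylor_bound_zero M (contDiff_ofReal_barnesF ha _)
  obtain ⟨C₁, hC₁0, hC₁⟩ := exists_multipleBernoulli_bound ha M R
  set D : ℕ → ℂ := fun j => iteratedDeriv j (fun t => (barnesF a t : ℂ)) 0 with hD
  refine ⟨C₀ * Real.exp R + ∑ j ∈ Finset.range (M + 1),
    ‖D j‖ * (R ^ (M + 1 - j) * Real.exp R) + C₁, fun w hw t ht => ?_⟩
  have ht0 : 0 < t := ht.1
  have hR : 0 ≤ R := (norm_nonneg _).trans hw
  have hnt : ‖(t : ℂ)‖ = t := by simp [abs_of_pos ht0]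
  have hwt : ‖-(w * (t : ℂ))‖ ≤ R := by
    rw [norm_neg, norm_mul, hnt]
    nlinarith [norm_nonneg w, ht.2]
  have hexp : ‖Complex.exp (-(w * t))‖ ≤ Real.exp R :=
    (Complex.norm_exp_le_exp_norm _).trans (Real.exp_le_exp.2 hwt)
  -- The numerator splits into the Taylor remainder of `f`, the remainders of the exponential, and
  -- the error of replacing `1` by `e^{-t}` in the top term. Each is `O(t^(M+1))`, which cancels the
  -- prefactor.
  have key : Complex.exp (-(w * t)) * (barnesF a t : ℂ)
      - ∑ k ∈ Finset.range M, (t : ℂ) ^ k / (k.factorial : ℂ) * multipleBernoulli k a w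
      - (t : ℂ) ^ M * Complex.exp (-(t : ℂ)) / (M.factorial : ℂ) * multipleBernoulli M a w
      = ((barnesF a t : ℂ) - ∑ k ∈ Finset.range (M + 1), (t : ℂ) ^ k / k.factorial * D k)
          * Complex.exp (-(w * t))
        + ∑ j ∈ Finset.range (M + 1), (t : ℂ) ^ j / j.factorial * D j *
          (Complex.exp (-(w * t)) - ∑ i ∈ Finset.range (M + 1 - j), (-(w * t)) ^ i / i.factorial)
        + (t : ℂ) ^ M * (1 - Complex.exp (-(t : ℂ))) / (M.factorial : ℂ)
          * multipleBernoulli M a w := by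
    have h := sum_multipleBernoulli_eq ha (M + 1) w t
    rw [Finset.sum_range_succ] at h
    simp_rw [mul_sub, Finset.sum_sub_distrib, ← Finset.sum_mul]
    linear_combination -h
  have hfac : ∀ k : ℕ, (1 : ℝ) ≤ k.factorial := fun k => by exact_mod_cast k.factorial_pos
  have b1 : ‖((barnesF a t : ℂ) - ∑ k ∈ Finset.range (M + 1), (t : ℂ) ^ k / k.factorial * D k)
          * Complex.exp (-(w * t))‖ ≤ C₀ * Real.exp R * t ^ (M + 1) := by
    have h := hC₀ t ⟨ht0.le, ht.2⟩
    rw [norm_mul]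
    calc _ ≤ (C₀ * t ^ (M + 1)) * Real.exp R :=
          mul_le_mul h hexp (norm_nonneg _) ((norm_nonneg _).trans h)
      _ = _ := by ring
  have b2 : ‖∑ j ∈ Finset.range (M + 1), (t : ℂ) ^ j / j.factorial * D j *
          (Complex.exp (-(w * t)) - ∑ i ∈ Finset.range (M + 1 - j), (-(w * t)) ^ i / i.factorial)‖
      ≤ (∑ j ∈ Finset.range (M + 1), ‖D j‖ * (R ^ (M + 1 - j) * Real.exp R)) * t ^ (M + 1) := by
    rw [Finset.sum_mul]
    refine norm_sum_le_of_le _ fun j hj => ?_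
    have hjM : j ≤ M + 1 := (Finset.mem_range.1 hj).le
    have h1 := Complex.norm_exp_sub_sum_le_norm_mul_exp (-(w * (t : ℂ))) (M + 1 - j)
    have h2 : ‖-(w * (t : ℂ))‖ ^ (M + 1 - j) * Real.exp ‖-(w * (t : ℂ))‖
        ≤ R ^ (M + 1 - j) * t ^ (M + 1 - j) * Real.exp R := by
      refine mul_le_mul ?_ (Real.exp_le_exp.2 hwt) (Real.exp_pos _).le (by positivity)
      rw [norm_neg, norm_mul, hnt, mul_pow]
      gcongr
    have h3 : ‖(t : ℂ) ^ j / j.factorial * D j‖ ≤ t ^ j * ‖D j‖ := by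
      rw [norm_mul, norm_div, norm_pow, hnt, Complex.norm_natCast]
      gcongr
      exact div_le_self (by positivity) (hfac j)
    rw [norm_mul]
    calc _ ≤ (t ^ j * ‖D j‖) * (R ^ (M + 1 - j) * t ^ (M + 1 - j) * Real.exp R) :=
          mul_le_mul h3 (h1.trans h2) (norm_nonneg _) (by positivity)
      _ = ‖D j‖ * (R ^ (M + 1 - j) * Real.exp R) * (t ^ j * t ^ (M + 1 - j)) := by ring
      _ = _ := by rw [← pow_add, Nat.add_sub_cancel' hjM]
  have b3 : ‖(t : ℂ) ^ M * (1 - Complex.exp (-(t : ℂ))) / (M.factorial : ℂ)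
          * multipleBernoulli M a w‖ ≤ C₁ * t ^ (M + 1) := by
    have h1 : ‖1 - Complex.exp (-(t : ℂ))‖ ≤ t := by
      rw [show (1 : ℂ) - Complex.exp (-(t : ℂ)) = ((1 - Real.exp (-t) : ℝ) : ℂ) by push_cast; rfl,
        Complex.norm_real, Real.norm_eq_abs, abs_of_pos (one_sub_exp_neg_pos ht0)]
      exact one_sub_exp_neg_le t
    rw [norm_mul, norm_div, norm_mul, norm_pow, hnt, Complex.norm_natCast]
    calc _ ≤ (t ^ M * t) * C₁ := by
          refine mul_le_mul ?_ (hC₁ w hw) (norm_nonneg _) (by positivity)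
          refine (div_le_self (by positivity) (hfac M)).trans ?_
          gcongr
      _ = _ := by ring
  unfold malmstenIntegrand
  rw [key, norm_mul, norm_inv, norm_pow, hnt, inv_mul_le_iff₀ (by positivity)]
  refine (norm_add_le_of_le (norm_add_le_of_le b1 b2) b3).trans (le_of_eq ?_)
  ring

/-- After division by `t^(M+1)`, polynomial growth of `f` leaves exponential decay, a polynomial of
degree below `M` leaves `t^{-2}`, and the last term carries `e^{-t}`. The constants depend on `R`
only, not on `ε`. -/
theorem exists_malmstenIntegrand_bound_Ioi (ha : ∀ i, 0 < a i) (R : ℝ) :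
    ∃ A B C : ℝ, ∀ ε : ℝ, ∀ w : ℂ, ‖w‖ ≤ R → ε ≤ w.re → ∀ t ∈ Ioi (1 : ℝ),
      ‖malmstenIntegrand a w t‖ ≤ A * Real.exp (-ε * t) + B * t ^ (-2 : ℝ) +
        C * Real.exp (-1 * t) := by
  choose B hB0 hB using fun k => exists_multipleBernoulli_bound ha k R
  refine ⟨∏ j, (1 + (a j)⁻¹), ∑ k ∈ Finset.range M, B k, B M, fun ε w hw hε t ht => ?_⟩
  have ht : 1 < t := ht
  have ht0 : 0 < t := by linarith
  have hnt : ‖(t : ℂ)‖ = t := by simp [abs_of_pos ht0]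
  have hfac : ∀ k : ℕ, (1 : ℝ) ≤ k.factorial := fun k => by exact_mod_cast k.factorial_pos
  have hP : 0 ≤ ∏ j, (1 + (a j)⁻¹) := Finset.prod_nonneg fun j _ => by
    have := inv_pos.2 (ha j); linarith
  have hMM : t ^ M ≤ t ^ (M + 1) := pow_le_pow_right₀ ht.le (Nat.le_succ M)
  have b1 : ‖Complex.exp (-(w * t)) * (barnesF a t : ℂ)‖
      ≤ (∏ j, (1 + (a j)⁻¹)) * Real.exp (-ε * t) * t ^ (M + 1) := by
    rw [norm_mul, Complex.norm_exp, Complex.norm_real, Real.norm_eq_abs,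
      abs_of_pos (barnesF_pos ha ht0.le)]
    have h1 : Real.exp (-(w * (t : ℂ))).re ≤ Real.exp (-ε * t) := by
      apply Real.exp_le_exp.2
      simp only [Complex.neg_re, Complex.mul_re, Complex.ofReal_re, Complex.ofReal_im]
      nlinarith
    have h2 : barnesF a t ≤ t ^ (M + 1) * ∏ j, (1 + (a j)⁻¹) :=
      (barnesF_le_pow ha ht.le).trans (mul_le_mul_of_nonneg_right hMM hP)
    calc _ ≤ Real.exp (-ε * t) * (t ^ (M + 1) * ∏ j, (1 + (a j)⁻¹)) :=
          mul_le_mul h1 h2 (barnesF_pos ha ht0.le).le (Real.exp_pos _).le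
      _ = _ := by ring
  have b2 : ‖∑ k ∈ Finset.range M, (t : ℂ) ^ k / (k.factorial : ℂ) * multipleBernoulli k a w‖
      ≤ (∑ k ∈ Finset.range M, B k) * t ^ (-2 : ℝ) * t ^ (M + 1) := by
    rw [mul_assoc, Finset.sum_mul]
    refine norm_sum_le_of_le _ fun k hk => ?_
    have hkM : k + 2 ≤ M + 1 := by have := Finset.mem_range.1 hk; omega
    rw [norm_mul, norm_div, norm_pow, hnt, Complex.norm_natCast]
    have e : t ^ (-2 : ℝ) * t ^ (M + 1) = t ^ (M + 1 - 2) := by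
      rw [Real.rpow_neg ht0.le, Real.rpow_two, inv_mul_eq_div, div_eq_iff (by positivity),
        ← pow_add]
      congr 1; omega
    rw [e, mul_comm]
    refine mul_le_mul (hB k w hw) ?_ (by positivity) (hB0 k)
    refine (div_le_self (by positivity) (hfac k)).trans ?_
    exact pow_le_pow_right₀ ht.le (by omega)
  have b3 : ‖(t : ℂ) ^ M * Complex.exp (-(t : ℂ)) / (M.factorial : ℂ) * multipleBernoulli M a w‖
      ≤ B M * Real.exp (-1 * t) * t ^ (M + 1) := by
    rw [norm_mul, norm_div, norm_mul, norm_pow, hnt, Complex.norm_natCast,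
      ← Complex.ofReal_neg, ← Complex.ofReal_exp, Complex.norm_real, Real.norm_eq_abs,
      Real.abs_exp, neg_one_mul]
    calc _ ≤ (t ^ (M + 1) * Real.exp (-t)) * B M := by
          refine mul_le_mul ?_ (hB M w hw) (norm_nonneg _) (by positivity)
          refine (div_le_self (by positivity) (hfac M)).trans ?_
          gcongr
      _ = _ := by ring
  unfold malmstenIntegrand
  rw [norm_mul, norm_inv, norm_pow, hnt, inv_mul_le_iff₀ (by positivity)]
  refine (norm_sub_le_of_le (norm_sub_le_of_le b1 b2) b3).trans (le_of_eq ?_)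
  ring

/-- A locally uniform integrable bound of the integrand of `malmstenLogGamma`. -/
theorem exists_malmstenIntegrand_dominated (ha : ∀ i, 0 < a i) (R : ℝ) {ε : ℝ} (hε : 0 < ε) :
    ∃ g : ℝ → ℝ, IntegrableOn g (Ioi 0) ∧ ∀ w : ℂ, ‖w‖ ≤ R → ε ≤ w.re → ∀ t ∈ Ioi (0 : ℝ),
      ‖malmstenIntegrand a w t‖ ≤ g t := by
  obtain ⟨C₀, h₀⟩ := exists_malmstenIntegrand_bound_Ioc ha R
  obtain ⟨A, B, C, h₁⟩ := exists_malmstenIntegrand_bound_Ioi ha R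
  refine ⟨_, integrableOn_Ioi_zero_ite (g₁ := fun _ => C₀) (g₂ := fun t =>
    A * Real.exp (-ε * t) + B * t ^ (-2 : ℝ) + C * Real.exp (-1 * t)) ?_ ?_,
    fun w hw hre t ht => ?_⟩
  · exact integrableOn_const (by simp)
  · exact (((integrableOn_exp_mul_Ioi (by linarith) 1).const_mul A).add
      ((integrableOn_Ioi_rpow_of_lt (by norm_num) one_pos).const_mul B)).add
      ((integrableOn_exp_mul_Ioi (by norm_num) 1).const_mul C)
  · split_ifs with h
    · exact h₀ w hw t ⟨ht, h⟩
    · exact h₁ ε w hw hre t (not_le.1 h)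

theorem aestronglyMeasurable_malmstenIntegrand (ha : ∀ i, 0 < a i) (w : ℂ) :
    AEStronglyMeasurable (malmstenIntegrand a w) (volume.restrict (Ioi 0)) := by
  refine Measurable.aestronglyMeasurable ?_
  have h := (continuous_barnesF ha).measurable
  have h' := contDiff_cexp_neg_mul w 0 |>.continuous.measurable
  unfold malmstenIntegrand
  fun_prop

theorem integrableOn_malmstenIntegrand (ha : ∀ i, 0 < a i) {w : ℂ} (hw : 0 < w.re) :
    IntegrableOn (malmstenIntegrand a w) (Ioi 0) := by
  obtain ⟨g, hg, h⟩ := exists_malmstenIntegrand_dominated ha ‖w‖ hw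
  refine Integrable.mono' hg (aestronglyMeasurable_malmstenIntegrand ha w) ?_
  filter_upwards [ae_restrict_mem measurableSet_Ioi] with t ht
  exact h w le_rfl le_rfl t ht

theorem differentiableOn_malmstenLogGamma (ha : ∀ i, 0 < a i) :
    DifferentiableOn ℂ (malmstenLogGamma a) {w | 0 < w.re} := by
  refine differentiableOn_integral_of_locally_dominated
    (isOpen_lt continuous_const Complex.continuous_re)
    (fun w _ => aestronglyMeasurable_malmstenIntegrand ha w)
    (Filter.Eventually.of_forall fun t => ?_) fun w₀ hw₀ => ?_
  · have := fun k => differentiable_multipleBernoulli ha k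
    fun_prop
  · have hw₀ : 0 < w₀.re := hw₀
    obtain ⟨g, hg, h⟩ := exists_malmstenIntegrand_dominated ha (‖w₀‖ + w₀.re / 2)
      (half_pos hw₀)
    refine ⟨w₀.re / 2, half_pos hw₀, g, hg, ?_⟩
    filter_upwards [ae_restrict_mem measurableSet_Ioi] with t ht w hw
    have h1 : ‖w - w₀‖ < w₀.re / 2 := by rwa [Metric.mem_ball, dist_eq_norm] at hw
    refine h w ?_ ?_ t ht
    · have := norm_le_norm_add_norm_sub' w w₀
      linarith
    · have := (abs_le.1 ((Complex.abs_re_le_norm (w - w₀)).trans h1.le)).1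
      rw [Complex.sub_re] at this
      linarith

/-- The counterterms obey the same shift as the main term: the factor `k` in `multipleBernoulli_add`
lowers `k!` to `(k-1)!`, so the subtracted sum is `t` times the sum of rank one less. -/
theorem malmstenIntegrand_add {N : ℕ} {a : Fin (N + 1) → ℝ} (ha : ∀ i, 0 < a i)
    (i : Fin (N + 1)) (w : ℂ) {t : ℝ} (ht : 0 < t) :
    malmstenIntegrand a (w + a i) t
      = malmstenIntegrand a w t - malmstenIntegrand (i.removeNth a) w t := by
  have ht0 : (t : ℂ) ≠ 0 := by exact_mod_cast ht.ne'
  unfold malmstenIntegrand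
  have h := congrArg (fun x : ℝ => (x : ℂ)) (barnesF_mul_one_sub_exp ha i t)
  push_cast at h
  have e : Complex.exp (-((w + a i) * t)) = Complex.exp (-(w * t)) * Complex.exp (-(a i * t)) := by
    rw [← Complex.exp_add]; congr 1; ring
  have hfac : ∀ k : ℕ, (k.factorial : ℂ) ≠ 0 := fun k => by exact_mod_cast k.factorial_ne_zero
  have hs : ∑ k ∈ Finset.range (N + 1), (t : ℂ) ^ k / (k.factorial : ℂ) *
        multipleBernoulli k a (w + a i)
      = ∑ k ∈ Finset.range (N + 1), (t : ℂ) ^ k / (k.factorial : ℂ) * multipleBernoulli k a w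
        - t * ∑ k ∈ Finset.range N, (t : ℂ) ^ k / (k.factorial : ℂ) *
          multipleBernoulli k (i.removeNth a) w := by
    simp_rw [multipleBernoulli_add ha i, mul_sub, Finset.sum_sub_distrib]
    congr 1
    rw [Finset.sum_range_succ', Finset.mul_sum]
    simp only [Nat.cast_zero, zero_mul, mul_zero, add_zero, Nat.add_sub_cancel]
    refine Finset.sum_congr rfl fun k _ => ?_
    rw [Nat.factorial_succ]
    push_cast
    have := hfac k
    have : (k : ℂ) + 1 ≠ 0 := by exact_mod_cast k.succ_ne_zero
    field_simp
    ring
  rw [hs, multipleBernoulli_add ha i, e, Nat.add_sub_cancel, Nat.factorial_succ]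
  have h1 := hfac N
  have h2 : (N : ℂ) + 1 ≠ 0 := by exact_mod_cast N.succ_ne_zero
  push_cast
  generalize Complex.exp (-(w * t)) = E at *
  generalize Complex.exp (-(a i * t)) = E' at *
  field_simp
  linear_combination (-(N.factorial * (N + 1) * t ^ (N + 1) : ℂ) * E) * h

theorem malmstenLogGamma_add {N : ℕ} {a : Fin (N + 1) → ℝ} (ha : ∀ i, 0 < a i)
    (i : Fin (N + 1)) {w : ℂ} (hw : 0 < w.re) :
    malmstenLogGamma a (w + a i)
      = malmstenLogGamma a w - malmstenLogGamma (i.removeNth a) w := by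
  simp only [malmstenLogGamma_eq_integral]
  rw [← integral_sub (integrableOn_malmstenIntegrand ha hw)
    (integrableOn_malmstenIntegrand (a := i.removeNth a) (fun j => ha _) hw)]
  exact setIntegral_congr_fun measurableSet_Ioi fun t ht => malmstenIntegrand_add ha i w ht

end Malmsten

/-! ### Continuation of the logarithm to the cut plane. -/

section Continuation

open Filter Topology

theorem isOpen_re_pos : IsOpen {w : ℂ | 0 < w.re} :=
  isOpen_lt continuous_const Complex.continuous_re

theorem isPreconnected_lt_re (σ : ℝ) : IsPreconnected {w : ℂ | σ < w.re} :=
  (convex_halfSpace_re_gt σ).isPreconnected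

theorem malmstenIntegrand_fin_zero (a : Fin 0 → ℝ) (w : ℂ) (t : ℝ) :
    malmstenIntegrand a w t = (t : ℂ)⁻¹ * (Complex.exp (-(w * t)) - Complex.exp (-(t : ℂ))) := by
  simp [malmstenIntegrand, barnesF, multipleBernoulli]

theorem integrableOn_frullani_exp {w : ℝ} (hw : 0 < w) :
    IntegrableOn (fun x : ℝ => x⁻¹ • (Real.exp (-(w * x)) - Real.exp (-(1 * x)))) (Ioi 0) := by
  have h := integrableOn_malmstenIntegrand (a := fun i : Fin 0 => i.elim0) (fun i => i.elim0)
    (w := (w : ℂ)) (by simpa using hw)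
  refine IntegrableOn.congr_fun (Integrable.re h) (fun x _ => ?_) measurableSet_Ioi
  have e : malmstenIntegrand (fun i : Fin 0 => i.elim0) (w : ℂ) x
      = ((x⁻¹ • (Real.exp (-(w * x)) - Real.exp (-(1 * x))) : ℝ) : ℂ) := by
    rw [malmstenIntegrand_fin_zero]
    simp
  rw [e]
  exact Complex.ofReal_re _

theorem integral_frullani_exp {w : ℝ} (hw : 0 < w) :
    ∫ x in Ioi (0 : ℝ), x⁻¹ • (Real.exp (-(w * x)) - Real.exp (-(1 * x))) = -Real.log w := by
  have h := Frullani.integral_Ioi_eq (f := fun x : ℝ => Real.exp (-x)) (a := w) (b := 1)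
    (L := 1) (R := 0) ((Continuous.locallyIntegrable (by fun_prop)).locallyIntegrableOn _)
    hw one_pos ?_ ?_ (integrableOn_frullani_exp hw)
  · rw [h]; simp
  · have : Continuous fun x : ℝ => Real.exp (-x) := by fun_prop
    simpa using (this.tendsto 0).mono_left nhdsWithin_le_nhds
  · exact Real.tendsto_exp_neg_atTop_nhds_zero

theorem malmstenLogGamma_fin_zero_ofReal (a : Fin 0 → ℝ) {w : ℝ} (hw : 0 < w) :
    malmstenLogGamma a w = -Complex.log w := by
  rw [← Complex.ofReal_log hw.le, ← Complex.ofReal_neg, ← integral_frullani_exp hw,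
    malmstenLogGamma_eq_integral, ← integral_complex_ofReal]
  refine setIntegral_congr_fun measurableSet_Ioi fun t _ => ?_
  simp [malmstenIntegrand_fin_zero]

/-- In rank zero the Malmsten integral is a Frullani integral for real `w`. The identity theorem,
with real points accumulating at `1`, extends the value to the half-plane. -/
theorem malmstenLogGamma_fin_zero (a : Fin 0 → ℝ) {w : ℂ} (hw : 0 < w.re) :
    malmstenLogGamma a w = -Complex.log w := by
  have h1 : AnalyticOnNhd ℂ (malmstenLogGamma a) {w | 0 < w.re} :=
    (differentiableOn_malmstenLogGamma (fun i => i.elim0)).analyticOnNhd isOpen_re_pos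
  have h2 : AnalyticOnNhd ℂ (fun w => -Complex.log w) {w | 0 < w.re} := by
    refine DifferentiableOn.analyticOnNhd (fun w hw => ?_) isOpen_re_pos
    exact (Complex.differentiableAt_log (Or.inl hw)).neg.differentiableWithinAt
  refine h1.eqOn_of_preconnected_of_frequently_eq h2 (isPreconnected_lt_re 0)
    (z₀ := 1) (by simp) ?_ hw
  have hlim : Tendsto (fun n : ℕ => (1 : ℂ) + ((1 / (n + 1 : ℝ) : ℝ) : ℂ)) atTop (𝓝[≠] 1) := by
    rw [tendsto_nhdsWithin_iff]
    constructor
    · have := ((Complex.continuous_ofReal.tendsto 0).comp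
        (tendsto_one_div_add_atTop_nhds_zero_nat (𝕜 := ℝ))).const_add (1 : ℂ)
      simpa [Function.comp_def] using this
    · refine Eventually.of_forall fun n => ?_
      simp only [mem_compl_iff, mem_singleton_iff, add_eq_left]
      exact_mod_cast (by positivity : (1 / (n + 1 : ℝ)) ≠ 0)
  refine hlim.frequently (Frequently.of_forall fun n => ?_)
  have e : (1 : ℂ) + ((1 / (n + 1 : ℝ) : ℝ) : ℂ) = ((1 + 1 / (n + 1 : ℝ) : ℝ) : ℂ) := by
    push_cast; ring
  rw [e]
  exact malmstenLogGamma_fin_zero_ofReal a (by positivity)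

theorem add_ofReal_mem_slitPlane {w : ℂ} (hw : w ∈ Complex.slitPlane) {x : ℝ} (hx : 0 ≤ x) :
    w + x ∈ Complex.slitPlane := by
  rcases hw with h | h
  · left; simp; linarith
  · right; simpa using h

/-- The holomorphic continuation of `malmstenLogGamma` exists. -/
theorem exists_isLogBarnesGamma : ∀ (M : ℕ) (a : Fin M → ℝ), (∀ i, 0 < a i) →
    ∃ F, IsLogBarnesGamma a F := by
  intro M
  induction M with
  | zero =>
    intro a _
    refine ⟨fun w => -Complex.log w, fun w hw => ?_, fun w hw => ?_⟩
    · exact (Complex.differentiableAt_log hw).neg.differentiableWithinAt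
    · exact (malmstenLogGamma_fin_zero a hw).symm
  | succ N ih =>
    intro a ha
    obtain ⟨G, hGd, hG⟩ := ih ((0 : Fin (N + 1)).removeNth a) fun j => ha _
    set c := a 0 with hc
    have hc0 : 0 < c := ha 0
    -- The shift formula iterated `n` times. Its first term is defined for `re w > -n c`, and its
    -- sum uses the continuation of lower rank.
    let F : ℕ → ℂ → ℂ := fun n w =>
      malmstenLogGamma a (w + (n * c : ℝ)) + ∑ k ∈ Finset.range n, G (w + (k * c : ℝ))
    have hstep : ∀ (n : ℕ) (w : ℂ), 0 < w.re + n * c → F (n + 1) w = F n w := by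
      intro n w hn
      have h0 : 0 < (w + (n * c : ℝ)).re := by simpa using hn
      have h1 := malmstenLogGamma_add ha 0 h0
      simp only [F]
      rw [Finset.sum_range_succ, hG _ h0,
        show w + ((n + 1 : ℕ) * c : ℝ) = w + (n * c : ℝ) + (a 0 : ℂ) by push_cast; ring, h1]
      ring
    have hle : ∀ (n m : ℕ) (w : ℂ), 0 < w.re + n * c → n ≤ m → F m w = F n w := by
      intro n m w hn hnm
      induction m, hnm using Nat.le_induction with
      | base => rfl
      | succ m hm ihm =>
        rw [hstep m w, ihm]
        have : (n : ℝ) ≤ m := by exact_mod_cast hm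
        nlinarith
    have heq : ∀ (n m : ℕ) (w : ℂ), 0 < w.re + n * c → 0 < w.re + m * c → F m w = F n w := by
      intro n m w hn hm
      rcases le_total n m with h | h
      · exact hle n m w hn h
      · exact (hle m n w hm h).symm
    have hex : ∀ w : ℂ, ∃ n : ℕ, 0 < w.re + n * c := by
      intro w
      obtain ⟨n, hn⟩ := exists_nat_gt (-w.re / c)
      refine ⟨n, ?_⟩
      rw [div_lt_iff₀ hc0] at hn
      linarith
    choose ν hν using hex
    refine ⟨fun w => F (ν w) w, fun w hw => ?_, fun w hw => ?_⟩
    · have hFd : DifferentiableAt ℂ (F (ν w)) w := by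
        refine DifferentiableAt.add ?_ (DifferentiableAt.fun_sum fun k _ => ?_)
        · have h0 : 0 < (w + (ν w * c : ℝ)).re := by simpa using hν w
          have := (differentiableOn_malmstenLogGamma ha).differentiableAt
            (isOpen_re_pos.mem_nhds h0)
          exact DifferentiableAt.comp (g := malmstenLogGamma a) w this
            (differentiableAt_id.add_const _)
        · have h0 : w + (k * c : ℝ) ∈ Complex.slitPlane :=
            add_ofReal_mem_slitPlane hw (by positivity)
          have := hGd.differentiableAt (Complex.isOpen_slitPlane.mem_nhds h0)
          exact this.comp w (differentiableAt_id.add_const _)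
      refine (hFd.congr_of_eventuallyEq ?_).differentiableWithinAt
      -- The index `ν z` may jump, but near `w` the fixed index `ν w` still works and gives the same
      -- value.
      have hopen : IsOpen {z : ℂ | 0 < z.re + ν w * c} :=
        isOpen_lt continuous_const (by fun_prop)
      filter_upwards [hopen.mem_nhds (hν w)] with z hz
      exact heq _ _ z hz (hν z)
    · have h0 : 0 < w.re + (0 : ℕ) * c := by simpa using hw
      have := heq 0 (ν w) w h0 (hν w)
      simp only [this]
      simp [F]

theorem isLogBarnesGamma_logBarnesGamma {M : ℕ} {a : Fin M → ℝ} (ha : ∀ i, 0 < a i) :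
    IsLogBarnesGamma a (logBarnesGamma a) := by
  have h := exists_isLogBarnesGamma M a ha
  unfold logBarnesGamma
  rw [dif_pos h]
  exact h.choose_spec

/-- The shifted function plus the one of lower rank is again a continuation of the same integral,
and the continuation is unique. -/
theorem logBarnesGamma_add {N : ℕ} {a : Fin (N + 1) → ℝ} (ha : ∀ i, 0 < a i)
    (i : Fin (N + 1)) {w : ℂ} (hw : w ∈ Complex.slitPlane) :
    logBarnesGamma a (w + a i)
      = logBarnesGamma a w - logBarnesGamma (i.removeNth a) w := by
  have h1 := isLogBarnesGamma_logBarnesGamma ha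
  have h2 := isLogBarnesGamma_logBarnesGamma (a := i.removeNth a) fun j => ha _
  have h : IsLogBarnesGamma a
      (fun w => logBarnesGamma a (w + a i) + logBarnesGamma (i.removeNth a) w) := by
    refine ⟨DifferentiableOn.add ?_ h2.1, fun w hw => ?_⟩
    · exact h1.1.comp (differentiableOn_id.add_const _)
        fun w hw => add_ofReal_mem_slitPlane hw (ha i).le
    · have h3 : 0 < (w + a i).re := by simpa using add_pos hw (ha i)
      simp only
      rw [h1.2 _ h3, h2.2 _ hw, malmstenLogGamma_add ha i hw]
      ring
  have := h.eqOn hw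
  rw [← this]; ring

end Continuation

/-! ### Functional equation and values of `η` at integers. -/

section FunctionalEquation

theorem add_sum_mem_slitPlane {N : ℕ} {b : Fin (N + 1) → ℝ} (hb : ∀ j, 0 < b j) {q : ℂ}
    (hq : q + b 0 ∈ Complex.slitPlane) (s : Finset (Fin N)) :
    q + b 0 + ∑ j ∈ s, (b j.succ : ℂ) ∈ Complex.slitPlane := by
  rw [← Complex.ofReal_sum]
  exact add_ofReal_mem_slitPlane hq (Finset.sum_nonneg fun j _ => (hb _).le)

theorem alternatingShift_logBarnesGamma_add {N K : ℕ} {a : Fin (N + 1) → ℝ}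
    {b : Fin (K + 1) → ℝ} (ha : ∀ i, 0 < a i) (hb : ∀ j, 0 < b j) (i : Fin (N + 1)) {q : ℂ}
    (hq : q + b 0 ∈ Complex.slitPlane) :
    alternatingShift (logBarnesGamma a) b (q + a i) = alternatingShift (logBarnesGamma a) b q
      - alternatingShift (logBarnesGamma (i.removeNth a)) b q := by
  unfold alternatingShift
  rw [← Finset.sum_sub_distrib]
  refine Finset.sum_congr rfl fun s _ => ?_
  rw [← mul_sub, ← logBarnesGamma_add ha i (add_sum_mem_slitPlane hb hq s)]
  congr 2
  ring

/-- The functional equation of the ratio of Barnes multiple gamma functions. -/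
theorem barnesEta_add {N K : ℕ} {a : Fin (N + 1) → ℝ}
    {b : Fin (K + 1) → ℝ} (ha : ∀ i, 0 < a i) (hb : ∀ j, 0 < b j) (i : Fin (N + 1)) {q : ℂ}
    (hq : q + b 0 ∈ Complex.slitPlane) :
    barnesEta a b (q + a i) = barnesEta a b q *
      Complex.exp (-alternatingShift (logBarnesGamma (i.removeNth a)) b q) := by
  unfold barnesEta
  rw [alternatingShift_logBarnesGamma_add ha hb i hq, ← Complex.exp_add]
  congr 1
  ring

theorem barnesEta_zero {M K : ℕ} (a : Fin M → ℝ) (b : Fin (K + 1) → ℝ) :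
    barnesEta a b 0 = 1 := by
  simp [barnesEta]

variable {N K : ℕ} {a : Fin (N + 1) → ℝ} {b : Fin (K + 1) → ℝ}

theorem barnesEta_natCast (ha : ∀ i, 0 < a i) (hb : ∀ j, 0 < b j) {i : Fin (N + 1)}
    (hi : a i = 1) (k : ℕ) :
    barnesEta a b k = Complex.exp (-∑ l ∈ Finset.range k,
      alternatingShift (logBarnesGamma (i.removeNth a)) b (l : ℂ)) := by
  induction k with
  | zero => simp [barnesEta_zero]
  | succ k ih =>
    have hq : (k : ℂ) + b 0 ∈ Complex.slitPlane := by
      left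
      simpa using add_pos_of_nonneg_of_pos (Nat.cast_nonneg k) (hb 0)
    have h := barnesEta_add ha hb i hq
    rw [hi, Complex.ofReal_one] at h
    rw [Finset.sum_range_succ, neg_add, Complex.exp_add, ← ih, ← h]
    push_cast; rfl

/-- The functional equation is run backwards from `0`. The condition `k < b 0` keeps every point
reached to the right of `-b 0`. -/
theorem barnesEta_neg_natCast (ha : ∀ i, 0 < a i) (hb : ∀ j, 0 < b j) {i : Fin (N + 1)}
    (hi : a i = 1) (k : ℕ) (hk : (k : ℝ) < b 0) :
    barnesEta a b (-(k : ℂ)) = Complex.exp (∑ l ∈ Finset.range k,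
      alternatingShift (logBarnesGamma (i.removeNth a)) b (-((l : ℂ) + 1))) := by
  induction k with
  | zero => simp [barnesEta_zero]
  | succ k ih =>
    push_cast at hk ⊢
    have hq : -((k : ℂ) + 1) + b 0 ∈ Complex.slitPlane := by
      left
      simp; linarith
    have h := barnesEta_add ha hb i hq
    rw [hi, Complex.ofReal_one, show -((k : ℂ) + 1) + 1 = -k by ring, ih (by linarith)] at h
    rw [Finset.sum_range_succ, Complex.exp_add, h, mul_assoc, ← Complex.exp_add]
    simp

end FunctionalEquation

/-! ### The smooth function `t K(t)`: value at zero and decay. -/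

section RegularKernel

variable {M N : ℕ}

/-- The function `t * levyKernel a b t` for `M = N + 1`, with the singularity at `0` removed. -/
noncomputable def regularKernel (a : Fin M → ℝ) (b : Fin (N + 1) → ℝ) (t : ℝ) : ℝ :=
  Real.exp (-(b 0 * t)) * (barnesF a t / barnesF (fun j : Fin N => b j.succ) t)

variable {a : Fin M → ℝ} {b : Fin (N + 1) → ℝ}

/-- Negative `t` is included because the quotient in `regularKernel` has to be smooth on a full
neighbourhood of `0`. -/
theorem barnesF_ne_zero (ha : ∀ i, 0 < a i) (t : ℝ) : barnesF a t ≠ 0 := by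
  rw [barnesF_eq_prod, Finset.prod_ne_zero_iff]
  intro j _ h
  have h1 := barnesFactor_mul (ha j) t
  rw [h, zero_mul] at h1
  rw [← h1] at h
  simp [barnesFactor, (ha j).ne'] at h

theorem contDiff_regularKernel (ha : ∀ i, 0 < a i) (hb : ∀ j, 0 < b j) (n : WithTop ℕ∞) :
    ContDiff ℝ n (regularKernel a b) := by
  have hb' : ∀ j : Fin N, 0 < b j.succ := fun j => hb _
  refine ContDiff.mul (by fun_prop) ((contDiff_barnesF ha n).div (contDiff_barnesF hb' n) ?_)
  exact barnesF_ne_zero hb'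

theorem continuous_regularKernel (ha : ∀ i, 0 < a i) (hb : ∀ j, 0 < b j) :
    Continuous (regularKernel a b) :=
  (contDiff_regularKernel ha hb 0).continuous

theorem regularKernel_pos (ha : ∀ i, 0 < a i) (hb : ∀ j, 0 < b j) {t : ℝ} (ht : 0 ≤ t) :
    0 < regularKernel a b t :=
  mul_pos (Real.exp_pos _) (div_pos (barnesF_pos ha ht) (barnesF_pos (fun _ => hb _) ht))

theorem regularKernel_zero (a : Fin M → ℝ) (b : Fin (N + 1) → ℝ) :
    regularKernel a b 0 = barnesRatio a b := by
  simp [regularKernel, barnesRatio, barnesF, div_eq_mul_inv, mul_comm]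

theorem barnesF_mul_prod (ha : ∀ i, 0 < a i) (t : ℝ) :
    barnesF a t * ∏ i, (1 - Real.exp (-(a i * t))) = t ^ M := by
  rw [barnesF_eq_prod, ← Finset.prod_mul_distrib,
    Finset.prod_congr rfl fun j _ => barnesFactor_mul (ha j) t, Fin.prod_const]

/-- Exhibits the zero of order `N` at `t = 0` that makes the low-degree Bernoulli terms disappear.
-/
theorem barnesF_mul_exp_mul_prod (hb : ∀ j, 0 < b j) (t : ℝ) :
    barnesF a t * (Real.exp (-(b 0 * t)) * ∏ j : Fin N, (1 - Real.exp (-(b j.succ * t))))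
      = t ^ N * regularKernel a b t := by
  have hb' : ∀ j : Fin N, 0 < b j.succ := fun j => hb _
  have h1 := barnesF_mul_prod hb' t
  have h2 := barnesF_ne_zero hb' t
  unfold regularKernel
  rw [← h1]
  field_simp

theorem mul_levyKernel {a b : Fin (N + 1) → ℝ} (ha : ∀ i, 0 < a i) (hb : ∀ j, 0 < b j) {t : ℝ}
    (ht : 0 < t) : t * levyKernel a b t = regularKernel a b t := by
  have h1 := barnesF_mul_exp_mul_prod (a := a) hb t
  have h2 := barnesF_mul_prod ha t
  have h3 : ∏ i, (1 - Real.exp (-(a i * t))) ≠ 0 := fun h => by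
    rw [h, mul_zero] at h2
    exact (pow_pos ht _).ne h2
  have h4 := barnesF_ne_zero ha t
  have ht' := ht.ne'
  have htN : t ^ N ≠ 0 := (pow_pos ht N).ne'
  unfold levyKernel
  refine mul_left_cancel₀ htN ?_
  rw [← h1, ← mul_assoc, ← pow_succ, ← h2]
  generalize (∏ i, (1 - Real.exp (-(a i * t)))) = P at *
  field_simp

theorem levyKernel_eq {a b : Fin (N + 1) → ℝ} (ha : ∀ i, 0 < a i) (hb : ∀ j, 0 < b j) {t : ℝ}
    (ht : 0 < t) : levyKernel a b t = regularKernel a b t / t := by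
  rw [← mul_levyKernel ha hb ht]
  field_simp

theorem barnesRatio_pos (ha : ∀ i, 0 < a i) (hb : ∀ j, 0 < b j) : 0 < barnesRatio a b :=
  div_pos (Finset.prod_pos fun _ _ => hb _) (Finset.prod_pos fun i _ => ha i)

theorem inv_le_barnesFactor {c t : ℝ} (hc : 0 < c) (ht : 0 ≤ t) : c⁻¹ ≤ barnesFactor c t := by
  rcases ht.eq_or_lt with rfl | ht
  · simp [barnesFactor]
  · rw [barnesFactor_of_ne ht.ne', inv_le_iff_one_le_mul₀ hc, div_mul_eq_mul_div,
      one_le_div (one_sub_exp_neg_pos (by positivity)), mul_comm t]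
    exact one_sub_exp_neg_le _

/-- `regularKernel a b` decays at infinity faster than `exp (-s t)` for every `s < b 0`. -/
theorem exists_regularKernel_le (ha : ∀ i, 0 < a i) (hb : ∀ j, 0 < b j) {s : ℝ} (hs : s < b 0) :
    ∃ C, 0 ≤ C ∧ ∀ t, 0 ≤ t → regularKernel a b t ≤ C * Real.exp (-s * t) := by
  have hb' : ∀ j : Fin N, 0 < b j.succ := fun j => hb _
  -- Each of the `M` linear factors `t + 1/a_i` is absorbed by one `e^{δt}`; the total loss `M δ`
  -- fits into the gap `b 0 - s`. The `+ 1` avoids a division by zero when `M = 0`.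
  set δ := (b 0 - s) / (M + 1) with hδ
  have hM : (0 : ℝ) < M + 1 := by positivity
  have hδ0 : 0 < δ := div_pos (by linarith) hM
  have hδM : M * δ ≤ b 0 - s := by
    have h1 : δ * (M + 1) = b 0 - s := div_mul_cancel₀ _ hM.ne'
    nlinarith
  refine ⟨(∏ i, (δ⁻¹ + (a i)⁻¹)) * ∏ j : Fin N, b j.succ, ?_, fun t ht => ?_⟩
  · refine mul_nonneg (Finset.prod_nonneg fun i _ => ?_) (Finset.prod_nonneg fun j _ => (hb _).le)
    have := ha i; positivity
  have h1 : barnesF a t ≤ (∏ i, (δ⁻¹ + (a i)⁻¹)) * Real.exp (M * δ * t) := by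
    refine (barnesF_le ha ht).trans ?_
    have e : Real.exp (M * δ * t) = ∏ _i : Fin M, Real.exp (δ * t) := by
      rw [Fin.prod_const, ← Real.exp_nat_mul]; congr 1; ring
    rw [e, ← Finset.prod_mul_distrib]
    refine Finset.prod_le_prod (fun i _ => ?_) fun i _ => ?_
    · have := ha i; positivity
    · have hai := inv_pos.2 (ha i)
      have h2 : δ * t ≤ Real.exp (δ * t) := by linarith [Real.add_one_le_exp (δ * t)]
      have h3 : 1 ≤ Real.exp (δ * t) := Real.one_le_exp (by positivity)
      have h4 : t ≤ δ⁻¹ * Real.exp (δ * t) := by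
        rw [inv_mul_eq_div, le_div_iff₀ hδ0]; linarith
      rw [add_mul]
      exact add_le_add h4 (le_mul_of_one_le_right hai.le h3)
  have h2 : (barnesF (fun j : Fin N => b j.succ) t)⁻¹ ≤ ∏ j : Fin N, b j.succ := by
    rw [barnesF_eq_prod, ← Finset.prod_inv_distrib]
    refine Finset.prod_le_prod (fun j _ => ?_) fun j _ => ?_
    · exact inv_nonneg.2 (barnesFactor_pos (hb' j) ht).le
    · exact inv_le_of_inv_le₀ (hb' j) (inv_le_barnesFactor (hb' j) ht)
  unfold regularKernel
  rw [div_eq_mul_inv]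
  have h3 : Real.exp (-(b 0 * t)) * Real.exp (M * δ * t) ≤ Real.exp (-s * t) := by
    rw [← Real.exp_add]
    apply Real.exp_le_exp.2
    nlinarith
  have hP : 0 ≤ ∏ i, (δ⁻¹ + (a i)⁻¹) := Finset.prod_nonneg fun i _ => by
    have := ha i; positivity
  have hQ : 0 ≤ ∏ j : Fin N, b j.succ := Finset.prod_nonneg fun j _ => (hb _).le
  calc _ ≤ Real.exp (-(b 0 * t)) * (((∏ i, (δ⁻¹ + (a i)⁻¹)) * Real.exp (M * δ * t))
          * ∏ j : Fin N, b j.succ) := by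
        refine mul_le_mul_of_nonneg_left ?_ (Real.exp_pos _).le
        exact mul_le_mul h1 h2 (inv_nonneg.2 (barnesF_pos hb' ht).le) (by positivity)
    _ = (∏ i, (δ⁻¹ + (a i)⁻¹)) * (∏ j : Fin N, b j.succ) *
        (Real.exp (-(b 0 * t)) * Real.exp (M * δ * t)) := by ring
    _ ≤ _ := mul_le_mul_of_nonneg_left h3 (mul_nonneg hP hQ)

theorem exists_le_regularKernel (ha : ∀ i, 0 < a i) (hb : ∀ j, 0 < b j) :
    ∃ c, 0 < c ∧ ∀ t ∈ Icc (0 : ℝ) 1, c ≤ regularKernel a b t := by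
  obtain ⟨t₀, ht₀, h⟩ := isCompact_Icc.exists_isMinOn (nonempty_Icc.2 zero_le_one)
    (continuous_regularKernel ha hb).continuousOn
  exact ⟨_, regularKernel_pos ha hb ht₀.1, fun t ht => h ht⟩

theorem exists_regularKernel_sub_le (ha : ∀ i, 0 < a i) (hb : ∀ j, 0 < b j) :
    ∃ C, ∀ t ∈ Icc (0 : ℝ) 1, |regularKernel a b t - barnesRatio a b| ≤ C * t := by
  obtain ⟨C, hC⟩ := exists_taylor_bound_zero (f := fun t => (regularKernel a b t : ℂ)) 0
    (Complex.ofRealCLM.contDiff.comp (contDiff_regularKernel ha hb _))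
  refine ⟨C, fun t ht => ?_⟩
  have := hC t ht
  rw [← Real.norm_eq_abs, ← Complex.norm_real, Complex.ofReal_sub]
  simpa [regularKernel_zero] using this

end RegularKernel

/-! ### Absolute convergence of the jump and drift integrals. -/

section Integrability

variable {N : ℕ} {a b : Fin (N + 1) → ℝ}

theorem norm_exp_sub_one_sub_le {z : ℂ} : ‖Complex.exp z - 1 - z‖ ≤ ‖z‖ ^ 2 * Real.exp ‖z‖ := by
  have := Complex.norm_exp_sub_sum_le_norm_mul_exp z 2
  simpa [Finset.sum_range_succ, sub_sub] using this

theorem integrableOn_levyJumpIntegrand (ha : ∀ i, 0 < a i) (hb : ∀ j, 0 < b j) {q : ℂ}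
    (hq : -b 0 < q.re) : IntegrableOn (levyJumpIntegrand a b q) (Ioi 0) := by
  have hb0 := hb 0
  -- The midpoint between `max 0 (-re q)` and `b 0`: the kernel decays like `e^{-st}`, and both `s`
  -- and `s + re q` are positive.
  set s := (max 0 (-q.re) + b 0) / 2 with hs
  have hmax : max 0 (-q.re) < b 0 := max_lt hb0 (by linarith)
  have hsb : s < b 0 := by rw [hs]; linarith
  have hs0 : 0 < s := by have := le_max_left 0 (-q.re); rw [hs]; linarith
  have hsq : 0 < s + q.re := by have := le_max_right 0 (-q.re); rw [hs]; linarith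
  obtain ⟨C, hC0, hC⟩ := exists_regularKernel_le ha hb hsb
  have hcont := continuous_regularKernel ha hb
  have hcongr : IntegrableOn (fun t : ℝ => (Complex.exp (-(t * q)) - 1 + q * t) *
      (regularKernel a b t : ℂ) / t ^ 2) (Ioi 0) := by
    refine Integrable.mono' (integrableOn_Ioi_zero_ite (g₁ := fun _ => ‖q‖ ^ 2 * Real.exp ‖q‖ * C)
      (g₂ := fun t => C * (Real.exp (-(s + q.re) * t) + Real.exp (-s * t)
        + ‖q‖ * (2 / s) * Real.exp (-(s / 2) * t))) ?_ ?_)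
      (Measurable.aestronglyMeasurable (by fun_prop)) ?_
    · exact integrableOn_const (by simp)
    · exact (((integrableOn_exp_mul_Ioi (by linarith) 1).add
        (integrableOn_exp_mul_Ioi (by linarith) 1)).add
        ((integrableOn_exp_mul_Ioi (by linarith) 1).const_mul _)).const_mul _
    · filter_upwards [ae_restrict_mem measurableSet_Ioi] with t ht
      have ht0 : 0 < t := ht
      have hnt : ‖(t : ℂ)‖ = t := by simp [abs_of_pos ht0]
      have hk := hC t ht0.le
      have hk0 := (regularKernel_pos ha hb ht0.le)
      rw [norm_div, norm_mul, norm_pow, hnt, Complex.norm_real, Real.norm_eq_abs,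
        abs_of_pos hk0, div_le_iff₀ (by positivity)]
      split_ifs with h1
      · have h2 := norm_exp_sub_one_sub_le (z := -(t * q))
        rw [sub_neg_eq_add, norm_neg, norm_mul, hnt] at h2
        rw [mul_comm q]
        have h3 : regularKernel a b t ≤ C := hk.trans (mul_le_of_le_one_right hC0
          (Real.exp_le_one_iff.2 (by nlinarith)))
        have h4 : Real.exp (t * ‖q‖) ≤ Real.exp ‖q‖ := Real.exp_le_exp.2
          (mul_le_of_le_one_left (norm_nonneg _) h1)
        calc _ ≤ ((t * ‖q‖) ^ 2 * Real.exp ‖q‖) * C := by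
              refine mul_le_mul (h2.trans ?_) h3 hk0.le (by positivity)
              gcongr
          _ = _ := by ring
      · have h1 : 1 < t := not_le.1 h1
        have h2 : ‖Complex.exp (-(t * q)) - 1 + q * t‖
            ≤ Real.exp (-q.re * t) + 1 + ‖q‖ * t := by
          refine norm_add_le_of_le (norm_sub_le_of_le ?_ (by simp)) ?_
          · rw [Complex.norm_exp]
            apply Real.exp_le_exp.2
            simp; linarith
          · rw [norm_mul, hnt]
        -- The compensator grows linearly; half of the decay rate `s` is spent on absorbing this
        -- factor `t`.
        have h3 : t ≤ 2 / s * Real.exp (s / 2 * t) := by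
          have := Real.add_one_le_exp (s / 2 * t)
          rw [div_mul_eq_mul_div, le_div_iff₀ hs0]
          linarith
        have e1 : Real.exp (-q.re * t) * Real.exp (-s * t) = Real.exp (-(s + q.re) * t) := by
          rw [← Real.exp_add]; congr 1; ring
        have e2 : Real.exp (s / 2 * t) * Real.exp (-s * t) = Real.exp (-(s / 2) * t) := by
          rw [← Real.exp_add]; congr 1; ring
        calc _ ≤ (Real.exp (-q.re * t) + 1 + ‖q‖ * (2 / s * Real.exp (s / 2 * t)))
              * (C * Real.exp (-s * t)) := by
              refine mul_le_mul (h2.trans ?_) hk hk0.le (by positivity)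
              gcongr
          _ = C * (Real.exp (-q.re * t) * Real.exp (-s * t) + Real.exp (-s * t) +
              ‖q‖ * (2 / s) * (Real.exp (s / 2 * t) * Real.exp (-s * t))) * 1 := by ring
          _ ≤ _ := by
              rw [e1, e2]
              refine mul_le_mul_of_nonneg_left (one_le_pow₀ h1.le) (by positivity)
  refine hcongr.congr_fun (fun t ht => ?_) measurableSet_Ioi
  have ht0 : (t : ℂ) ≠ 0 := by exact_mod_cast (ne_of_gt ht)
  simp only [levyJumpIntegrand]
  rw [levyKernel_eq ha hb ht]
  push_cast
  field_simp

theorem measurable_levyKernel {M N : ℕ} (a : Fin M → ℝ) (b : Fin (N + 1) → ℝ) :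
    Measurable (levyKernel a b) := by
  unfold levyKernel; fun_prop

theorem levyKernel_nonneg {M N : ℕ} {a : Fin M → ℝ} {b : Fin (N + 1) → ℝ} (ha : ∀ i, 0 < a i)
    (hb : ∀ j, 0 < b j) {t : ℝ} (ht : 0 < t) : 0 ≤ levyKernel a b t := by
  refine div_nonneg (mul_nonneg (Real.exp_pos _).le (Finset.prod_nonneg fun j _ => ?_))
    (Finset.prod_nonneg fun i _ => ?_)
  · exact (one_sub_exp_neg_pos (mul_pos (hb _) ht)).le
  · exact (one_sub_exp_neg_pos (mul_pos (ha _) ht)).le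

/-- Both terms behave as `r/t + O(1)` at `0`, so their singularities cancel; at infinity each decays
exponentially. -/
theorem integrableOn_levyDriftIntegrand (ha : ∀ i, 0 < a i) (hb : ∀ j, 0 < b j) :
    IntegrableOn (levyDriftIntegrand a b) (Ioi 0) := by
  obtain ⟨C, hC0, hC⟩ := exists_regularKernel_le ha hb (half_lt_self (hb 0))
  obtain ⟨D, hD⟩ := exists_regularKernel_sub_le ha hb
  have hr := barnesRatio_pos ha hb
  have hb0 := hb 0
  refine Integrable.mono' (integrableOn_Ioi_zero_ite (g₁ := fun _ => barnesRatio a b + D)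
      (g₂ := fun t => barnesRatio a b * Real.exp (-1 * t) + C * Real.exp (-(b 0 / 2) * t)) ?_ ?_)
      (Measurable.aestronglyMeasurable ?_) ?_
  · exact integrableOn_const (by simp)
  · exact ((integrableOn_exp_mul_Ioi (by linarith) 1).const_mul _).add
      ((integrableOn_exp_mul_Ioi (by linarith) 1).const_mul _)
  · have := measurable_levyKernel a b
    unfold levyDriftIntegrand
    fun_prop
  · filter_upwards [ae_restrict_mem measurableSet_Ioi] with t ht
    have ht0 : 0 < t := ht
    have hk0 := (regularKernel_pos ha hb ht0.le)
    have e : levyDriftIntegrand a b t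
        = (Real.exp (-t) * barnesRatio a b - regularKernel a b t) / t := by
      rw [levyDriftIntegrand, levyKernel_eq ha hb ht0]; ring
    rw [e, norm_div, Real.norm_eq_abs, Real.norm_eq_abs, abs_of_pos ht0, div_le_iff₀ ht0]
    split_ifs with h1
    · have h2 := hD t ⟨ht0.le, h1⟩
      have h3 : |(Real.exp (-t) - 1) * barnesRatio a b| ≤ barnesRatio a b * t := by
        rw [abs_mul, abs_of_pos hr, abs_sub_comm, abs_of_pos (one_sub_exp_neg_pos ht0), mul_comm]
        exact mul_le_mul_of_nonneg_left (one_sub_exp_neg_le t) hr.le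
      calc _ = |(Real.exp (-t) - 1) * barnesRatio a b
            - (regularKernel a b t - barnesRatio a b)| := by congr 1; ring
        _ ≤ _ := (abs_sub _ _).trans (add_le_add h3 h2)
        _ = _ := by ring
    · have h1 : 1 < t := not_le.1 h1
      have h2 := hC t ht0.le
      calc _ ≤ Real.exp (-t) * barnesRatio a b + regularKernel a b t := by
            refine (abs_sub _ _).trans (le_of_eq ?_)
            rw [abs_of_pos (by positivity), abs_of_pos hk0]
        _ ≤ (barnesRatio a b * Real.exp (-1 * t) + C * Real.exp (-(b 0 / 2) * t)) * 1 := by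
            rw [mul_one, neg_one_mul, mul_comm]
            gcongr
        _ ≤ _ := mul_le_mul_of_nonneg_left h1.le (by positivity)

end Integrability

/-! ### From the Malmsten integral to the Lévy–Khinchine exponent. -/

section Representation

variable {M N : ℕ}

/-- Inclusion–exclusion: expanding the product over subsets of the `b_j` gives the signed sum of
exponentials. -/
theorem alternatingShift_cexp (b : Fin (N + 1) → ℝ) (q : ℂ) (t : ℝ) :
    alternatingShift (fun w => Complex.exp (-(w * t))) b q = Complex.exp (-(q * t)) *
      ((Real.exp (-(b 0 * t)) * ∏ j : Fin N, (1 - Real.exp (-(b j.succ * t))) : ℝ) : ℂ) := by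
  have h : ∏ j : Fin N, (1 - Complex.exp (-(b j.succ * t)))
      = ∑ s : Finset (Fin N), (-1) ^ s.card * Complex.exp (-((∑ j ∈ s, (b j.succ : ℂ)) * t)) := by
    simp_rw [sub_eq_add_neg]
    rw [Finset.prod_one_add, Finset.powerset_univ]
    refine Finset.sum_congr rfl fun s _ => ?_
    rw [Finset.prod_neg, Finset.sum_mul, ← Finset.sum_neg_distrib, Complex.exp_sum]
  push_cast
  rw [h, Finset.mul_sum, Finset.mul_sum]
  refine Finset.sum_congr rfl fun s _ => ?_
  beta_reduce
  rw [show -((q + b 0 + ∑ j ∈ s, (b j.succ : ℂ)) * t)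
    = -(q * t) + (-(b 0 * t) + -((∑ j ∈ s, (b j.succ : ℂ)) * t)) by ring, Complex.exp_add,
    Complex.exp_add]
  ring

variable {a : Fin M → ℝ} {b : Fin (N + 1) → ℝ}

theorem ofReal_barnesF_mul_exp_mul_prod (hb : ∀ j, 0 < b j) (t : ℝ) :
    (barnesF a t : ℂ) *
      ((Real.exp (-(b 0 * t)) * ∏ j : Fin N, (1 - Real.exp (-(b j.succ * t))) : ℝ) : ℂ)
      = (t : ℂ) ^ N * (regularKernel a b t : ℂ) := by
  rw [← Complex.ofReal_mul, barnesF_mul_exp_mul_prod hb, Complex.ofReal_mul, Complex.ofReal_pow]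

theorem alternatingShift_multipleBernoulli (ha : ∀ i, 0 < a i) (k : ℕ) (q : ℂ) :
    alternatingShift (multipleBernoulli k a) b q = iteratedDeriv k (fun t : ℝ => (barnesF a t : ℂ) *
      alternatingShift (fun w => Complex.exp (-(w * t))) b q) 0 := by
  have e : (fun t : ℝ => (barnesF a t : ℂ) *
      alternatingShift (fun w => Complex.exp (-(w * t))) b q)
      = fun t : ℝ => ∑ s : Finset (Fin N), (-1) ^ s.card * ((barnesF a t : ℂ) *
        Complex.exp (-((q + b 0 + ∑ j ∈ s, (b j.succ : ℂ)) * t))) := by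
    funext t
    rw [alternatingShift, Finset.mul_sum]
    refine Finset.sum_congr rfl fun s _ => ?_
    ring
  rw [e, iteratedDeriv_fun_sum fun s _ => (contDiff_const.mul
    ((contDiff_ofReal_barnesF ha _).mul (contDiff_cexp_neg_mul _ _))).contDiffAt]
  refine Finset.sum_congr rfl fun s _ => ?_
  rw [iteratedDeriv_const_mul_field]
  rfl

/-- The shifted generating function carries a factor `t^N`, and subtracting its value at `q = 0`
adds one more zero. So the difference vanishes for `k ≤ N`, and at `k = N + 1` only a first
derivative survives. -/
theorem alternatingShift_multipleBernoulli_sub (ha : ∀ i, 0 < a i) (hb : ∀ j, 0 < b j) (k : ℕ)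
    (q : ℂ) :
    alternatingShift (multipleBernoulli k a) b q - alternatingShift (multipleBernoulli k a) b 0
      = k.descFactorial N * iteratedDeriv (k - N) (fun t : ℝ =>
        (regularKernel a b t : ℂ) * (Complex.exp (-(q * t)) - 1)) 0 := by
  have hS : ∀ (p : ℂ), (fun t : ℝ => (barnesF a t : ℂ) *
      alternatingShift (fun w => Complex.exp (-(w * t))) b p)
      = fun t : ℝ => (t : ℂ) ^ N * ((regularKernel a b t : ℂ) * Complex.exp (-(p * t))) := by
    intro p
    funext t
    have h := ofReal_barnesF_mul_exp_mul_prod (a := a) hb t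
    rw [alternatingShift_cexp]
    linear_combination Complex.exp (-(p * t)) * h
  have hk : ∀ n : WithTop ℕ∞, ContDiff ℝ n (fun t => (regularKernel a b t : ℂ)) := fun n =>
    Complex.ofRealCLM.contDiff.comp (contDiff_regularKernel ha hb n)
  have hp : ContDiff ℝ k (fun t : ℝ => (t : ℂ) ^ N) := Complex.ofRealCLM.contDiff.pow N
  have hG : ∀ p : ℂ, ContDiff ℝ k (fun t : ℝ => (t : ℂ) ^ N *
      ((regularKernel a b t : ℂ) * Complex.exp (-(p * t)))) := fun p =>
    hp.mul ((hk _).mul (contDiff_cexp_neg_mul p _))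
  rw [alternatingShift_multipleBernoulli ha, alternatingShift_multipleBernoulli ha, hS, hS,
    ← iteratedDeriv_fun_sub (hG q).contDiffAt (hG 0).contDiffAt, ← iteratedDeriv_pow_mul_zero N k
    ((hk _).mul ((contDiff_cexp_neg_mul q _).sub contDiff_const)).contDiffAt]
  congr 1
  funext t
  simp
  ring

theorem deriv_regularKernel_mul_exp_sub_one (ha : ∀ i, 0 < a i) (hb : ∀ j, 0 < b j) (q : ℂ) :
    deriv (fun t : ℝ => (regularKernel a b t : ℂ) * (Complex.exp (-(q * t)) - 1)) 0
      = -(q * barnesRatio a b) := by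
  have h1 : HasDerivAt (fun t : ℝ => Complex.exp (-(q * t)) - 1)
      (Complex.exp (-(q * (0 : ℝ))) * (-(q * 1))) 0 :=
    ((Complex.ofRealCLM.hasDerivAt (x := (0 : ℝ))).const_mul q).neg.cexp.sub_const 1
  have h2 : DifferentiableAt ℝ (fun t => (regularKernel a b t : ℂ)) 0 :=
    (Complex.ofRealCLM.contDiff.comp (contDiff_regularKernel ha hb 1)).differentiable
      one_ne_zero |>.differentiableAt
  rw [(h2.hasDerivAt.fun_mul h1).deriv, regularKernel_zero]
  simp
  ring

variable {a b : Fin (N + 1) → ℝ}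

/-- The integrand of the logarithm of `barnesEta`. -/
noncomputable def barnesExponentIntegrand {M N : ℕ} (a : Fin M → ℝ) (b : Fin (N + 1) → ℝ) (q : ℂ)
    (t : ℝ) : ℂ :=
  ((Complex.exp (-(q * t)) - 1) * levyKernel a b t + q * barnesRatio a b * Real.exp (-t)) / t

/-- The decisive cancellation: all counterterms of degree at most `N` agree at `q` and `0`, and the
top one changes by `-(N+1)! q r`, which becomes the term with `e^{-t}`. -/
theorem alternatingShift_malmstenIntegrand_sub (ha : ∀ i, 0 < a i) (hb : ∀ j, 0 < b j) (q : ℂ)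
    {t : ℝ} (ht : 0 < t) :
    alternatingShift (fun w => malmstenIntegrand a w t) b q
      - alternatingShift (fun w => malmstenIntegrand a w t) b 0
      = barnesExponentIntegrand a b q t := by
  have hlin : ∀ p : ℂ, alternatingShift (fun w => malmstenIntegrand a w t) b p
      = ((t : ℂ) ^ (N + 2))⁻¹ *
        ((barnesF a t : ℂ) * alternatingShift (fun w => Complex.exp (-(w * t))) b p
        - ∑ k ∈ Finset.range (N + 1), (t : ℂ) ^ k / (k.factorial : ℂ) *
          alternatingShift (multipleBernoulli k a) b p
        - (t : ℂ) ^ (N + 1) * Complex.exp (-(t : ℂ)) / ((N + 1).factorial : ℂ) *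
          alternatingShift (multipleBernoulli (N + 1) a) b p) := by
    intro p
    simp only [alternatingShift, malmstenIntegrand, Finset.mul_sum]
    rw [Finset.sum_comm, ← Finset.sum_sub_distrib, ← Finset.sum_sub_distrib, Finset.mul_sum]
    refine Finset.sum_congr rfl fun s _ => ?_
    simp only [mul_sub, Finset.mul_sum]
    congr 1
    · congr 1
      · ring
      · exact Finset.sum_congr rfl fun k _ => by ring
    · ring
  have hΔ := alternatingShift_multipleBernoulli_sub ha hb (q := q)
  have hlow : ∑ k ∈ Finset.range (N + 1), (t : ℂ) ^ k / (k.factorial : ℂ) *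
        alternatingShift (multipleBernoulli k a) b q
      = ∑ k ∈ Finset.range (N + 1), (t : ℂ) ^ k / (k.factorial : ℂ) *
        alternatingShift (multipleBernoulli k a) b 0 := by
    refine Finset.sum_congr rfl fun k hk => ?_
    have h := hΔ k
    have hkN : k ≤ N := Nat.lt_succ_iff.1 (Finset.mem_range.1 hk)
    rw [sub_eq_iff_eq_add.1 h]
    rcases hkN.lt_or_eq with h' | rfl
    · rw [Nat.descFactorial_eq_zero_iff_lt.2 h']; simp
    · simp
  have htop : alternatingShift (multipleBernoulli (N + 1) a) b q
      = alternatingShift (multipleBernoulli (N + 1) a) b 0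
        - (N + 1).factorial * (q * barnesRatio a b) := by
    have h := hΔ (N + 1)
    rw [Nat.add_sub_cancel_left, iteratedDeriv_one, deriv_regularKernel_mul_exp_sub_one ha hb] at h
    have e : ((N + 1).descFactorial N : ℂ) = (N + 1).factorial := by
      have := Nat.factorial_mul_descFactorial (Nat.le_succ N)
      rw [Nat.succ_sub (le_refl N), Nat.sub_self, Nat.factorial_one, one_mul] at this
      exact_mod_cast this
    rw [e] at h
    linear_combination h
  have h := ofReal_barnesF_mul_exp_mul_prod (a := a) hb t
  rw [← mul_levyKernel ha hb ht, Complex.ofReal_mul t] at h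
  have ht0 : (t : ℂ) ≠ 0 := by exact_mod_cast ht.ne'
  have hf : ((N + 1).factorial : ℂ) ≠ 0 := by exact_mod_cast (N + 1).factorial_ne_zero
  rw [hlin, hlin, hlow, htop, alternatingShift_cexp, alternatingShift_cexp, barnesExponentIntegrand,
    ← Complex.ofReal_neg, ← Complex.ofReal_exp]
  rw [zero_mul, neg_zero, Complex.exp_zero]
  generalize (((Real.exp (-(b 0 * t)) * ∏ j : Fin N, (1 - Real.exp (-(b j.succ * t))) : ℝ) : ℂ))
    = P at *
  generalize alternatingShift (multipleBernoulli (N + 1) a) b 0 = B at *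
  generalize ∑ k ∈ Finset.range (N + 1), (t : ℂ) ^ k / (k.factorial : ℂ) *
        alternatingShift (multipleBernoulli k a) b 0 = S at *
  generalize Complex.exp (-(q * t)) = E at *
  field_simp
  linear_combination ((N + 1).factorial * t * (E - 1) : ℂ) * h

theorem integrableOn_alternatingShift_malmstenIntegrand {M : ℕ} {a : Fin M → ℝ}
    {b : Fin (N + 1) → ℝ} (ha : ∀ i, 0 < a i) (hb : ∀ j, 0 < b j) {q : ℂ} (hq : -b 0 < q.re) :
    IntegrableOn (fun t => alternatingShift (fun w => malmstenIntegrand a w t) b q) (Ioi 0) ∧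
    ∫ t in Ioi (0 : ℝ), alternatingShift (fun w => malmstenIntegrand a w t) b q
      = alternatingShift (logBarnesGamma a) b q := by
  have hre : ∀ s : Finset (Fin N), 0 < (q + b 0 + ∑ j ∈ s, (b j.succ : ℂ)).re := by
    intro s
    have h1 : 0 ≤ ∑ j ∈ s, b j.succ := Finset.sum_nonneg fun j _ => (hb _).le
    rw [← Complex.ofReal_sum]
    simp; linarith
  have hint : ∀ s ∈ (Finset.univ : Finset (Finset (Fin N))), Integrable (fun t =>
      (-1) ^ s.card * malmstenIntegrand a (q + b 0 + ∑ j ∈ s, (b j.succ : ℂ)) t)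
      (volume.restrict (Ioi 0)) := fun s _ =>
    (integrableOn_malmstenIntegrand ha (hre s)).const_mul _
  unfold alternatingShift
  refine ⟨integrable_finsetSum _ hint, ?_⟩
  rw [integral_finsetSum _ hint]
  refine Finset.sum_congr rfl fun s _ => ?_
  rw [logBarnesGamma_of_re_pos a (hre s), integral_const_mul, malmstenLogGamma_eq_integral]

theorem integrableOn_barnesExponentIntegrand (ha : ∀ i, 0 < a i) (hb : ∀ j, 0 < b j) {q : ℂ}
    (hq : -b 0 < q.re) : IntegrableOn (barnesExponentIntegrand a b q) (Ioi 0) := by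
  have h0 : -b 0 < (0 : ℂ).re := by simpa using hb 0
  refine IntegrableOn.congr_fun
    ((integrableOn_alternatingShift_malmstenIntegrand ha hb hq).1.sub
      (integrableOn_alternatingShift_malmstenIntegrand ha hb h0).1) (fun t ht => ?_)
    measurableSet_Ioi
  exact alternatingShift_malmstenIntegrand_sub ha hb q ht

theorem integral_barnesExponentIntegrand (ha : ∀ i, 0 < a i) (hb : ∀ j, 0 < b j) {q : ℂ}
    (hq : -b 0 < q.re) : ∫ t in Ioi (0 : ℝ), barnesExponentIntegrand a b q t
      = alternatingShift (logBarnesGamma a) b q - alternatingShift (logBarnesGamma a) b 0 := by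
  have h0 : -b 0 < (0 : ℂ).re := by simpa using hb 0
  have h1 := integrableOn_alternatingShift_malmstenIntegrand ha hb hq
  have h2 := integrableOn_alternatingShift_malmstenIntegrand ha hb h0
  rw [← h1.2, ← h2.2, ← integral_sub h1.1 h2.1]
  exact setIntegral_congr_fun measurableSet_Ioi fun t ht =>
    (alternatingShift_malmstenIntegrand_sub ha hb q ht).symm

theorem integral_barnesExponentIntegrand_eq_levy (ha : ∀ i, 0 < a i) (hb : ∀ j, 0 < b j) {q : ℂ}
    (hq : -b 0 < q.re) : ∫ t in Ioi (0 : ℝ), barnesExponentIntegrand a b q t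
      = (∫ t in Ioi (0 : ℝ), levyJumpIntegrand a b q t) +
            q * ((∫ t in Ioi (0 : ℝ), levyDriftIntegrand a b t : ℝ) : ℂ) := by
  have hd : IntegrableOn (fun t => q * (levyDriftIntegrand a b t : ℂ)) (Ioi 0) :=
    (integrableOn_levyDriftIntegrand ha hb).ofReal.const_mul q
  rw [← integral_complex_ofReal, ← integral_const_mul, ← integral_add
    (integrableOn_levyJumpIntegrand ha hb hq) hd]
  -- Adding and subtracting `q t K(t)` splits the integrand into a compensated jump part and a
  -- drift, each separately integrable.
  refine setIntegral_congr_fun measurableSet_Ioi fun t ht => ?_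
  have ht0 : (t : ℂ) ≠ 0 := by exact_mod_cast (ne_of_gt ht)
  simp only [barnesExponentIntegrand, levyJumpIntegrand, levyDriftIntegrand]
  push_cast
  rw [mul_comm q (t : ℂ)]
  field_simp
  ring

/-- The Lévy-Khinchine exponent of `barnesEta`. -/
theorem barnesEta_eq_exp (ha : ∀ i, 0 < a i) (hb : ∀ j, 0 < b j) {q : ℂ} (hq : -b 0 < q.re) :
    barnesEta a b q = Complex.exp ((∫ t in Ioi (0 : ℝ), levyJumpIntegrand a b q t) +
            q * ((∫ t in Ioi (0 : ℝ), levyDriftIntegrand a b t : ℝ) : ℂ)) := by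
  rw [← integral_barnesExponentIntegrand_eq_levy ha hb hq, integral_barnesExponentIntegrand ha hb hq]
  rfl

/-- Holomorphy is inherited from the continued Barnes functions through the representation, with no
differentiation under the jump integral. -/
theorem differentiableOn_levyExponent (ha : ∀ i, 0 < a i) (hb : ∀ j, 0 < b j) :
    DifferentiableOn ℂ (fun q => (∫ t in Ioi (0 : ℝ), levyJumpIntegrand a b q t) +
            q * ((∫ t in Ioi (0 : ℝ), levyDriftIntegrand a b t : ℝ) : ℂ)) {q | -b 0 < q.re} := by
  have h : DifferentiableOn ℂ (fun q => alternatingShift (logBarnesGamma a) b q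
      - alternatingShift (logBarnesGamma a) b 0) {q | -b 0 < q.re} := by
    refine DifferentiableOn.sub_const ?_ _
    refine DifferentiableOn.fun_sum fun s _ => DifferentiableOn.const_mul ?_ _
    refine (isLogBarnesGamma_logBarnesGamma ha).1.comp (by fun_prop) fun q hq => ?_
    refine add_sum_mem_slitPlane hb (Or.inl ?_) s
    have hq : -b 0 < q.re := hq
    simp; linarith
  refine h.congr fun q hq => ?_
  rw [← integral_barnesExponentIntegrand_eq_levy ha hb hq, integral_barnesExponentIntegrand ha hb hq]

end Representation

/-! ### Scaling of the parameters. -/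

section Scaling

variable {N : ℕ} {a b : Fin (N + 1) → ℝ}

theorem barnesRatio_mul (a b : Fin (N + 1) → ℝ) {κ : ℝ} (hκ : 0 < κ) :
    κ * barnesRatio (fun i => κ * a i) (fun j => κ * b j) = barnesRatio a b := by
  simp only [barnesRatio, Finset.prod_mul_distrib, Fin.prod_const]
  have h1 := hκ.ne'
  by_cases h : ∏ i, a i = 0
  · simp [h]
  · field_simp
    ring

theorem levyKernel_mul (a b : Fin (N + 1) → ℝ) (κ t : ℝ) :
    levyKernel (fun i => κ * a i) (fun j => κ * b j) t = levyKernel a b (κ * t) := by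
  have h : ∀ c : ℝ, κ * c * t = c * (κ * t) := fun c => by ring
  simp only [levyKernel, h]

theorem barnesEta_mul (ha : ∀ i, 0 < a i) (hb : ∀ j, 0 < b j) {κ : ℝ} (hκ : 0 < κ) {q : ℂ}
    (hq : -b 0 < q.re) :
    barnesEta (fun i => κ * a i) (fun j => κ * b j) (κ * q)
      = Complex.exp (q * barnesRatio a b * Real.log κ) * barnesEta a b q := by
  have hκ0 : (κ : ℂ) ≠ 0 := by exact_mod_cast hκ.ne'
  have hq' : -(κ * b 0) < ((κ : ℂ) * q).re := by
    rw [Complex.re_ofReal_mul, ← mul_neg]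
    exact mul_lt_mul_of_pos_left hq hκ
  have h1 := integral_barnesExponentIntegrand (fun i => mul_pos hκ (ha i))
    (fun j => mul_pos hκ (hb j)) hq'
  have h2 := integral_barnesExponentIntegrand ha hb hq
  unfold barnesEta
  rw [← h1, ← h2, ← Complex.exp_add]
  congr 1
  have hfr := integral_frullani_exp (inv_pos.2 hκ)
  rw [Real.log_inv, neg_neg] at hfr
  have hfi : IntegrableOn (fun s : ℝ => q * barnesRatio a b *
      ((s⁻¹ • (Real.exp (-(κ⁻¹ * s)) - Real.exp (-(1 * s))) : ℝ) : ℂ)) (Ioi 0) :=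
    (integrableOn_frullani_exp (inv_pos.2 hκ)).ofReal.const_mul _
  -- The substitution `s = κ t` turns `e^{-t}` into `e^{-s/κ}`. The discrepancy with `e^{-s}` is a
  -- Frullani integrand, whose integral is `log κ`.
  set g : ℝ → ℂ := fun s => barnesExponentIntegrand a b q s + q * barnesRatio a b *
    ((s⁻¹ • (Real.exp (-(κ⁻¹ * s)) - Real.exp (-(1 * s))) : ℝ) : ℂ) with hg
  have h3 : ∫ t in Ioi (0 : ℝ), barnesExponentIntegrand (fun i => κ * a i) (fun j => κ * b j)
      (κ * q) t = ∫ t in Ioi (0 : ℝ), κ • g (κ * t) := by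
    refine setIntegral_congr_fun measurableSet_Ioi fun t ht => ?_
    have ht0 : (t : ℂ) ≠ 0 := by exact_mod_cast (ne_of_gt ht)
    have hr := congrArg (fun x : ℝ => (x : ℂ)) (barnesRatio_mul a b hκ)
    simp only [Complex.ofReal_mul] at hr
    simp only [hg, barnesExponentIntegrand, levyKernel_mul, inv_mul_cancel_left₀ hκ.ne', one_mul]
    rw [← hr, Complex.real_smul]
    push_cast
    rw [show -((κ : ℂ) * q * t) = -(q * (κ * t)) by ring]
    simp only [smul_eq_mul]
    push_cast
    field_simp
    ring
  rw [h3, integral_smul, integral_comp_mul_left_Ioi _ _ hκ, mul_zero, smul_smul,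
    mul_inv_cancel₀ hκ.ne', one_smul,
    integral_add (integrableOn_barnesExponentIntegrand ha hb hq) hfi, integral_const_mul]
  have : ∫ s in Ioi (0 : ℝ), ((s⁻¹ • (Real.exp (-(κ⁻¹ * s)) - Real.exp (-(1 * s))) : ℝ) : ℂ)
      = ((Real.log κ : ℝ) : ℂ) := by
    rw [← hfr]; exact integral_complex_ofReal
  rw [this, add_comm]

end Scaling

/-! ### Exponential transforms: uniqueness, limits, convolution powers and compound Poisson laws. -/

section ExpTransform

open Filter Topology

/-- The transform `q ↦ ∫ exp (q y) dμ(y)` of the probability measure `μ` exists on the half-plane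
`σ < re q` and equals `φ` there. -/
structure HasExpTransform (μ : Measure ℝ) (σ : ℝ) (φ : ℂ → ℂ) : Prop where
  isProbabilityMeasure : IsProbabilityMeasure μ
  integrable : ∀ q : ℂ, σ < q.re → Integrable (fun y : ℝ => Complex.exp (q * y)) μ
  integral_eq : ∀ q : ℂ, σ < q.re → ∫ y : ℝ, Complex.exp (q * y) ∂μ = φ q

theorem HasExpTransform.charFun_eq {μ : Measure ℝ} {σ : ℝ} {φ : ℂ → ℂ}
    (h : HasExpTransform μ σ φ) (hσ : σ < 0) (t : ℝ) : charFun μ t = φ (t * Complex.I) := by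
  rw [charFun_apply_real, ← h.integral_eq _ (by simpa using hσ)]
  refine integral_congr_ae (Eventually.of_forall fun y => ?_)
  simp only
  congr 1; ring

/-- As `σ < 0`, the half-plane contains the imaginary axis, where the transform is the
characteristic function. -/
theorem HasExpTransform.unique {μ ν : Measure ℝ} {σ : ℝ} {φ : ℂ → ℂ}
    (h : HasExpTransform μ σ φ) (h' : HasExpTransform ν σ φ) (hσ : σ < 0) : μ = ν := by
  have := h.isProbabilityMeasure
  have := h'.isProbabilityMeasure
  refine Measure.ext_of_charFun (funext fun t => ?_)
  rw [h.charFun_eq hσ, h'.charFun_eq hσ]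

/-- Pointwise limits of transforms are transforms, provided that the limit is holomorphic. -/
theorem exists_hasExpTransform_of_tendsto {σ : ℝ} (hσ : σ < 0) {μ : ℕ → Measure ℝ}
    {φs : ℕ → ℂ → ℂ} {φ : ℂ → ℂ} (h : ∀ n, HasExpTransform (μ n) σ (φs n))
    (hφ : DifferentiableOn ℂ φ {q | σ < q.re})
    (hlim : ∀ q : ℂ, σ < q.re → Tendsto (fun n => φs n q) atTop (𝓝 (φ q))) :
    ∃ ν, HasExpTransform ν σ φ := by
  have hopen : IsOpen {q : ℂ | σ < q.re} := isOpen_lt continuous_const Complex.continuous_re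
  have hprob := fun n => (h n).isProbabilityMeasure
  have hchar : ∀ t : ℝ, Tendsto (fun n => charFun (μ n) t) atTop (𝓝 (φ (t * Complex.I))) := by
    intro t
    simp_rw [(h _).charFun_eq hσ]
    exact hlim _ (by simpa using hσ)
  have hcont : ContinuousAt (fun t : ℝ => φ (t * Complex.I)) 0 := by
    have h0 : ContinuousAt φ (((0 : ℝ) : ℂ) * Complex.I) :=
      (hφ.differentiableAt (hopen.mem_nhds (by simpa using hσ))).continuousAt
    exact ContinuousAt.comp (f := fun t : ℝ => (t : ℂ) * Complex.I) h0 (by fun_prop)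
  -- Continuity at `0` of the limit of the characteristic functions prevents mass from escaping to
  -- infinity; Prokhorov's theorem then provides a weakly convergent subsequence.
  have htight := isTightMeasureSet_of_tendsto_charFun hcont hchar
  let P : ℕ → ProbabilityMeasure ℝ := fun n => ⟨μ n, hprob n⟩
  have hcomp : IsCompact (closure (range P)) := by
    refine isCompact_closure_of_isTightMeasureSet ?_
    convert htight using 1
    ext ν
    constructor
    · rintro ⟨_, ⟨n, rfl⟩, rfl⟩
      exact ⟨n, rfl⟩
    · rintro ⟨n, rfl⟩
      exact ⟨P n, ⟨n, rfl⟩, rfl⟩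
  obtain ⟨ν, -, ψ, hψ, hν⟩ := hcomp.tendsto_subseq fun n => subset_closure (mem_range_self n)
  have hprobν : IsProbabilityMeasure (ν : Measure ℝ) := ν.2
  have hopens : ∀ G, IsOpen G → (ν : Measure ℝ) G ≤ atTop.liminf fun i => μ (ψ i) G :=
    fun G hG => ProbabilityMeasure.le_liminf_measure_open_of_tendsto hν hG
  -- The exponential is unbounded, so weak convergence does not apply to it directly. The
  -- portmanteau inequality on open sets gives a Fatou bound, finite because the transforms
  -- converge.
  have hint : ∀ x : ℝ, σ < x → Integrable (fun y : ℝ => Real.exp (x * y)) (ν : Measure ℝ) := by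
    intro x hx
    have hx' : σ < (x : ℂ).re := by simpa using hx
    refine ⟨by fun_prop, ?_⟩
    rw [hasFiniteIntegral_iff_ofReal (Eventually.of_forall fun y => (Real.exp_pos _).le)]
    refine (lintegral_le_liminf_lintegral_of_forall_isOpen_measure_le_liminf_measure
      (f := fun y : ℝ => Real.exp (x * y)) (by fun_prop) (fun y => (Real.exp_pos _).le)
      hopens).trans_lt ?_
    have hint' : ∀ n, Integrable (fun y : ℝ => Real.exp (x * y)) (μ n) := by
      intro n
      refine ((h n).integrable x hx').re.congr (Eventually.of_forall fun y => ?_)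
      simp only [RCLike.re_to_complex]
      rw [← Complex.ofReal_mul, ← Complex.ofReal_exp, Complex.ofReal_re]
    have hval : ∀ n, ∫⁻ y, ENNReal.ofReal (Real.exp (x * y)) ∂(μ n)
        = ENNReal.ofReal (φs n x).re := by
      intro n
      rw [← ofReal_integral_eq_lintegral_ofReal (hint' n)
        (Eventually.of_forall fun y => (Real.exp_pos _).le), ← (h n).integral_eq x hx']
      congr 1
      rw [← Complex.ofReal_re (∫ y, Real.exp (x * y) ∂(μ n)), ← integral_complex_ofReal]
      push_cast
      rfl
    simp_rw [hval]
    have hl : Tendsto (fun i => ENNReal.ofReal (φs (ψ i) x).re) atTop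
        (𝓝 (ENNReal.ofReal (φ x).re)) :=
      ENNReal.tendsto_ofReal ((Complex.continuous_re.tendsto _).comp
        ((hlim x hx').comp hψ.tendsto_atTop))
    rw [hl.liminf_eq]
    exact ENNReal.ofReal_lt_top
  have hset : ∀ q : ℂ, σ < q.re →
      q.re ∈ interior (ProbabilityTheory.integrableExpSet id (ν : Measure ℝ)) := by
    intro q hq
    refine mem_interior.2 ⟨Ioi σ, fun x hx => hint x hx, isOpen_Ioi, hq⟩
  have hcharν : ∀ t : ℝ, charFun (ν : Measure ℝ) t = φ (t * Complex.I) := by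
    intro t
    refine tendsto_nhds_unique ?_ ((hchar t).comp hψ.tendsto_atTop)
    rw [ProbabilityMeasure.tendsto_iff_forall_integral_rclike_tendsto ℂ] at hν
    simp_rw [Function.comp_def, charFun_eq_integral_innerProbChar]
    exact hν (BoundedContinuousFunction.innerProbChar t)
  refine ⟨ν, hprobν, fun q hq => ?_, fun q hq => ?_⟩
  · refine (hint q.re hq).mono' (by fun_prop) (Eventually.of_forall fun y => ?_)
    rw [Complex.norm_exp]
    simp
  · have h1 : AnalyticOnNhd ℂ (ProbabilityTheory.complexMGF id (ν : Measure ℝ)) {q | σ < q.re} :=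
      fun q hq => ProbabilityTheory.analyticAt_complexMGF (hset q hq)
    have hlim0 : Tendsto (fun n : ℕ => ((1 / (n + 1 : ℝ) : ℝ) : ℂ) * Complex.I) atTop (𝓝[≠] 0) := by
      rw [tendsto_nhdsWithin_iff]
      constructor
      · have := ((Complex.continuous_ofReal.tendsto 0).comp
          (tendsto_one_div_add_atTop_nhds_zero_nat (𝕜 := ℝ))).mul_const Complex.I
        simpa [Function.comp_def] using this
      · refine Eventually.of_forall fun n => ?_
        simp only [mem_compl_iff, mem_singleton_iff]
        refine mul_ne_zero ?_ Complex.I_ne_zero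
        exact_mod_cast (by positivity : (1 / (n + 1 : ℝ)) ≠ 0)
    exact h1.eqOn_of_preconnected_of_frequently_eq (hφ.analyticOnNhd hopen)
      (isPreconnected_lt_re σ) (z₀ := 0) (by simpa using hσ)
      (hlim0.frequently (Frequently.of_forall fun n => by
        rw [ProbabilityTheory.complexMGF_id_mul_I, hcharν])) hq

theorem HasExpTransform.map_add_const {μ : Measure ℝ} {σ : ℝ} {φ : ℂ → ℂ}
    (h : HasExpTransform μ σ φ) (d : ℝ) :
    HasExpTransform (μ.map (· + d)) σ (fun q => φ q * Complex.exp (q * d)) := by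
  have := h.isProbabilityMeasure
  have e : ∀ (q : ℂ) (y : ℝ), Complex.exp (q * ((y + d : ℝ) : ℂ))
      = Complex.exp (q * y) * Complex.exp (q * d) := by
    intro q y
    rw [← Complex.exp_add]; push_cast; congr 1; ring
  refine ⟨Measure.isProbabilityMeasure_map (by fun_prop), fun q hq => ?_, fun q hq => ?_⟩
  · rw [integrable_map_measure (by fun_prop) (by fun_prop)]
    exact ((h.integrable q hq).mul_const _).congr (Eventually.of_forall fun y => (e q y).symm)
  · rw [integral_map (by fun_prop) (by fun_prop)]
    simp_rw [e]
    rw [integral_mul_const, h.integral_eq q hq]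

/-- The `n`-fold convolution power of a measure on `ℝ`. -/
noncomputable def convolutionPower (ν : Measure ℝ) (n : ℕ) : Measure ℝ :=
  (Measure.pi fun _ : Fin n => ν).map (fun x => ∑ i, x i)

theorem integrable_exp_convolutionPower {ν : Measure ℝ} [IsFiniteMeasure ν] {q : ℂ}
    (h : Integrable (fun y : ℝ => Complex.exp (q * y)) ν) (n : ℕ) :
    Integrable (fun y : ℝ => Complex.exp (q * y)) (convolutionPower ν n) ∧
      ∫ y : ℝ, Complex.exp (q * y) ∂(convolutionPower ν n)
        = (∫ y : ℝ, Complex.exp (q * y) ∂ν) ^ n := by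
  have e : ∀ x : Fin n → ℝ, Complex.exp (q * ((∑ i, x i : ℝ) : ℂ))
      = ∏ i, Complex.exp (q * x i) := by
    intro x
    rw [← Complex.exp_sum, Complex.ofReal_sum, Finset.mul_sum]
  unfold convolutionPower
  constructor
  · rw [integrable_map_measure (by fun_prop) (by fun_prop)]
    exact (Integrable.fintype_prod (fun _ => h)).congr (Eventually.of_forall fun x => (e x).symm)
  · rw [integral_map (by fun_prop) (by fun_prop)]
    simp_rw [e]
    exact (integral_fintype_prod_eq_pow fun y : ℝ => Complex.exp (q * y)).trans
      (by rw [Fintype.card_fin])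

theorem HasExpTransform.convolutionPower {ν : Measure ℝ} {σ : ℝ} {φ : ℂ → ℂ}
    (h : HasExpTransform ν σ φ) (n : ℕ) :
    HasExpTransform (convolutionPower ν n) σ (fun q => φ q ^ n) := by
  have := h.isProbabilityMeasure
  refine ⟨Measure.isProbabilityMeasure_map (by fun_prop), fun q hq => ?_, fun q hq => ?_⟩
  · exact (integrable_exp_convolutionPower (h.integrable q hq) n).1
  · rw [(integrable_exp_convolutionPower (h.integrable q hq) n).2, h.integral_eq q hq]

/-- The compound Poisson distribution with finite jump measure `ν`. -/
noncomputable def compoundPoisson (ν : Measure ℝ) : Measure ℝ :=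
  Measure.sum fun n : ℕ =>
    ENNReal.ofReal (Real.exp (-ν.real univ) * (n.factorial : ℝ)⁻¹) • convolutionPower ν n

/-- The `n`-th convolution power contributes the `n`-th power of the transform of `ν`, so the
Poisson weights sum up to the exponential series. -/
theorem integrable_exp_compoundPoisson {ν : Measure ℝ} [IsFiniteMeasure ν] {q : ℂ}
    (h : Integrable (fun y : ℝ => Complex.exp (q * y)) ν) :
    Integrable (fun y : ℝ => Complex.exp (q * y)) (compoundPoisson ν) ∧
      ∫ y : ℝ, Complex.exp (q * y) ∂(compoundPoisson ν)
        = Complex.exp (∫ y : ℝ, Complex.exp (q * y) ∂ν - ν.real univ) := by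
  have hpos : ∀ n : ℕ, 0 ≤ Real.exp (-ν.real univ) * (n.factorial : ℝ)⁻¹ := fun n => by positivity
  have hnorm : ∀ y : ℝ, ((‖Complex.exp (q * y)‖ : ℝ) : ℂ) = Complex.exp ((q.re : ℂ) * y) := by
    intro y
    rw [Complex.norm_exp]
    simp
  have hre : Integrable (fun y : ℝ => Complex.exp ((q.re : ℂ) * y)) ν := by
    simp_rw [← hnorm]
    exact h.norm.ofReal
  have hnormpow : ∀ n, ∫ y : ℝ, ‖Complex.exp (q * y)‖ ∂(convolutionPower ν n)
      = (∫ y : ℝ, ‖Complex.exp (q * y)‖ ∂ν) ^ n := by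
    intro n
    have h2 := (integrable_exp_convolutionPower hre n).2
    simp_rw [← hnorm] at h2
    rw [integral_complex_ofReal, integral_complex_ofReal] at h2
    exact_mod_cast h2
  have hint : Integrable (fun y : ℝ => Complex.exp (q * y)) (compoundPoisson ν) := by
    refine integrable_sum_measure
      (fun n => (integrable_exp_convolutionPower h n).1.smul_measure ENNReal.ofReal_ne_top) ?_
    have hs := (Real.summable_pow_div_factorial
      (∫ y : ℝ, ‖Complex.exp (q * y)‖ ∂ν)).mul_left (Real.exp (-ν.real univ))
    refine hs.congr fun n => ?_
    rw [integral_smul_measure, ENNReal.toReal_ofReal (hpos n), hnormpow, smul_eq_mul]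
    ring
  refine ⟨hint, (hasSum_integral_measure hint).unique ?_⟩
  have hs := (NormedSpace.expSeries_div_hasSum_exp
    (∫ y : ℝ, Complex.exp (q * y) ∂ν)).mul_left (Complex.exp (-ν.real univ))
  rw [← Complex.exp_eq_exp_ℂ, ← Complex.exp_add, neg_add_eq_sub] at hs
  refine hs.congr_fun fun n => ?_
  rw [integral_smul_measure, ENNReal.toReal_ofReal (hpos n),
    (integrable_exp_convolutionPower h n).2, Complex.real_smul]
  push_cast
  ring

theorem hasExpTransform_compoundPoisson {ν : Measure ℝ} [IsFiniteMeasure ν] {σ : ℝ}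
    (h : ∀ q : ℂ, σ < q.re → Integrable (fun y : ℝ => Complex.exp (q * y)) ν) :
    HasExpTransform (compoundPoisson ν) σ
      (fun q => Complex.exp (∫ y : ℝ, Complex.exp (q * y) ∂ν - ν.real univ)) := by
  refine ⟨?_, fun q hq => (integrable_exp_compoundPoisson (h q hq)).1,
    fun q hq => (integrable_exp_compoundPoisson (h q hq)).2⟩
  have h0 : Integrable (fun y : ℝ => Complex.exp ((0 : ℂ) * y)) ν := by simp
  obtain ⟨h1, h2⟩ := integrable_exp_compoundPoisson h0
  have h3 : IsFiniteMeasure (compoundPoisson ν) := by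
    have : Integrable (fun _ : ℝ => (1 : ℂ)) (compoundPoisson ν) := by simpa using h1
    exact (integrable_const_iff_isFiniteMeasure one_ne_zero).1 this
  rw [isProbabilityMeasure_iff_real]
  have h4 : ((compoundPoisson ν).real univ : ℂ) = 1 := by simpa using h2
  exact_mod_cast h4

end ExpTransform

/-! ### Laws with a given Lévy density on the negative half-line. -/

section LevyMeasure

open Filter Topology

/-- The image under `t ↦ -t` of the measure with density `k` on `(ε, ∞)`. -/
noncomputable def truncatedLevyMeasure (k : ℝ → ℝ) (ε : ℝ) : Measure ℝ :=
  ((volume.restrict (Ioi ε)).withDensity fun t => ENNReal.ofReal (k t)).map fun t => -t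

theorem integral_truncatedLevyMeasure {k : ℝ → ℝ} (hk : Measurable k) {ε : ℝ}
    (hk0 : ∀ t ∈ Ioi ε, 0 ≤ k t) {f : ℝ → ℂ} (hf : Measurable f)
    (hfi : IntegrableOn (fun t => f (-t) * k t) (Ioi ε)) :
    Integrable f (truncatedLevyMeasure k ε) ∧
      ∫ y, f y ∂(truncatedLevyMeasure k ε) = ∫ t in Ioi ε, f (-t) * k t := by
  have hm : Measurable fun t : ℝ => ENNReal.ofReal (k t) := by fun_prop
  have hlt : ∀ᵐ t ∂(volume.restrict (Ioi ε)), ENNReal.ofReal (k t) < ⊤ :=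
    Eventually.of_forall fun t => ENNReal.ofReal_lt_top
  have e : ∀ t ∈ Ioi ε, (ENNReal.ofReal (k t)).toReal • f (-t) = f (-t) * k t := by
    intro t ht
    rw [ENNReal.toReal_ofReal (hk0 t ht), Complex.real_smul, mul_comm]
  have hfn : Measurable fun t : ℝ => f (-t) := hf.comp measurable_neg
  unfold truncatedLevyMeasure
  constructor
  · rw [integrable_map_measure hf.aestronglyMeasurable (by fun_prop)]
    rw [integrable_withDensity_iff_integrable_smul' hm hlt]
    exact IntegrableOn.congr_fun hfi (fun t ht => (e t ht).symm) measurableSet_Ioi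
  · rw [integral_map (by fun_prop) hf.aestronglyMeasurable,
      integral_withDensity_eq_integral_toReal_smul hm hlt]
    exact setIntegral_congr_fun measurableSet_Ioi e

/-- Existence of an infinitely divisible distribution with one-sided exponential moments and
prescribed Lévy measure `k(t) dt`, charging negative jumps only. -/
theorem exists_hasExpTransform_levy {σ : ℝ} (hσ : σ < 0) {k : ℝ → ℝ} (hk : Measurable k)
    (hk0 : ∀ t, 0 < t → 0 ≤ k t)
    (hjump : ∀ q : ℂ, σ < q.re →
      IntegrableOn (fun t : ℝ => (Complex.exp (-(t * q)) - 1 + q * t) * (k t : ℂ)) (Ioi 0))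
    (htail : ∀ ε, 0 < ε → IntegrableOn k (Ioi ε))
    (hmean : ∀ ε, 0 < ε → IntegrableOn (fun t => t * k t) (Ioi ε)) (d : ℝ)
    (hdiff : DifferentiableOn ℂ (fun q : ℂ =>
      (∫ t in Ioi (0 : ℝ), (Complex.exp (-(t * q)) - 1 + q * t) * (k t : ℂ)) + q * d)
      {q | σ < q.re}) :
    ∃ ν, HasExpTransform ν σ (fun q => Complex.exp
      ((∫ t in Ioi (0 : ℝ), (Complex.exp (-(t * q)) - 1 + q * t) * (k t : ℂ)) + q * d)) := by
  let J : ℂ → ℝ → ℂ := fun q t => (Complex.exp (-(t * q)) - 1 + q * t) * (k t : ℂ)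
  have hstep : ∀ ε : ℝ, 0 < ε → ∃ ν, HasExpTransform ν σ
      (fun q => Complex.exp ((∫ t in Ioi ε, J q t) + q * d)) := by
    intro ε hε
    have hk0' : ∀ t ∈ Ioi ε, 0 ≤ k t := fun t ht => hk0 t (hε.trans ht)
    have hsub : Ioi ε ⊆ Ioi (0 : ℝ) := Ioi_subset_Ioi hε.le
    have h1 : IntegrableOn (fun t => (k t : ℂ)) (Ioi ε) := (htail ε hε).ofReal
    have h2 : IntegrableOn (fun t => ((t * k t : ℝ) : ℂ)) (Ioi ε) := (hmean ε hε).ofReal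
    have hexp : ∀ q : ℂ, σ < q.re →
        IntegrableOn (fun t : ℝ => Complex.exp (q * ((-t : ℝ) : ℂ)) * (k t : ℂ)) (Ioi ε) := by
      intro q hq
      refine (((hjump q hq).mono_set hsub).add (h1.sub (h2.const_mul q))).congr
        (Eventually.of_forall fun t => ?_)
      simp only [Pi.add_apply, Pi.sub_apply]
      push_cast
      rw [show q * -(t : ℂ) = -(t * q) by ring]
      ring
    have hI := fun (q : ℂ) (hq : σ < q.re) => integral_truncatedLevyMeasure hk hk0'
      (f := fun y : ℝ => Complex.exp (q * y)) (by fun_prop) (hexp q hq)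
    have hfin : IsFiniteMeasure (truncatedLevyMeasure k ε) := by
      have h : IsFiniteMeasure
          ((volume.restrict (Ioi ε)).withDensity fun t => ENNReal.ofReal (k t)) :=
        isFiniteMeasure_withDensity_ofReal (htail ε hε).2
      unfold truncatedLevyMeasure
      infer_instance
    have hmass : ((truncatedLevyMeasure k ε).real univ : ℂ) = ∫ t in Ioi ε, (k t : ℂ) := by
      have := (hI 0 (by simpa using hσ)).2
      simpa using this
    -- Away from `0` the compensator `q ∫ t k(t) dt` is finite, so it is supplied by a translation,
    -- together with the drift `d`.
    have hcp := (hasExpTransform_compoundPoisson fun q hq => (hI q hq).1).map_add_const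
      (d + ∫ t in Ioi ε, t * k t)
    refine ⟨_, hcp.isProbabilityMeasure, hcp.integrable, fun q hq => ?_⟩
    rw [hcp.integral_eq q hq, ← Complex.exp_add, (hI q hq).2, hmass]
    congr 1
    have h12 : IntegrableOn
        (fun t : ℝ => Complex.exp (q * ((-t : ℝ) : ℂ)) * (k t : ℂ) - (k t : ℂ)) (Ioi ε) :=
      (hexp q hq).sub h1
    have h3 : ∫ t in Ioi ε, J q t = (∫ t in Ioi ε, Complex.exp (q * ((-t : ℝ) : ℂ)) * (k t : ℂ))
        - (∫ t in Ioi ε, (k t : ℂ)) + q * ∫ t in Ioi ε, ((t * k t : ℝ) : ℂ) := by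
      rw [← integral_const_mul, ← integral_sub (hexp q hq) h1,
        ← integral_add h12 (h2.const_mul q)]
      refine integral_congr_ae (Eventually.of_forall fun t => ?_)
      simp only [J]
      push_cast
      rw [show q * -(t : ℂ) = -(t * q) by ring]
      ring
    have h4 : ∫ t in Ioi ε, ((t * k t : ℝ) : ℂ) = ((∫ t in Ioi ε, t * k t : ℝ) : ℂ) :=
      integral_complex_ofReal
    rw [h3, h4, Complex.ofReal_add]
    ring
  choose! ν hν using hstep
  have hε : ∀ n : ℕ, (0 : ℝ) < 1 / (n + 1) := fun n => by positivity
  refine exists_hasExpTransform_of_tendsto hσ (fun n => hν _ (hε n)) hdiff.cexp fun q hq => ?_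
  refine (Complex.continuous_exp.tendsto _).comp (Tendsto.add_const _ ?_)
  have hU : ⋃ n : ℕ, Ioi (1 / ((n : ℝ) + 1)) = Ioi (0 : ℝ) := by
    refine Subset.antisymm (iUnion_subset fun n => Ioi_subset_Ioi (hε n).le) fun t ht => ?_
    obtain ⟨n, hn⟩ := exists_nat_one_div_lt (mem_Ioi.1 ht)
    exact mem_iUnion.2 ⟨n, hn⟩
  have h := tendsto_setIntegral_of_monotone (μ := volume) (f := J q)
    (s := fun n : ℕ => Ioi (1 / ((n : ℝ) + 1))) (fun n => measurableSet_Ioi)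
    (fun m n hmn => Ioi_subset_Ioi (Nat.one_div_le_one_div hmn)) (by rw [hU]; exact hjump q hq)
  rwa [hU] at h

end LevyMeasure

/-! ### The exponent of the logarithm: convolution roots and decay of the characteristic function.
-/

section BarnesLaw

variable {N : ℕ} {a b : Fin (N + 1) → ℝ}

/-- The Lévy exponent of the logarithm of the Barnes beta distribution. -/
noncomputable def barnesLevyExponent (a b : Fin (N + 1) → ℝ) (q : ℂ) : ℂ :=
  (∫ t in Ioi (0 : ℝ), levyJumpIntegrand a b q t) +
    q * ((∫ t in Ioi (0 : ℝ), levyDriftIntegrand a b t : ℝ) : ℂ)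

theorem integrableOn_levyKernel_Ioi (ha : ∀ i, 0 < a i) (hb : ∀ j, 0 < b j) {ε : ℝ} (hε : 0 < ε) :
    IntegrableOn (levyKernel a b) (Ioi ε) := by
  obtain ⟨C, hC0, hC⟩ := exists_regularKernel_le ha hb (half_lt_self (hb 0))
  have hb0 := hb 0
  have hg : IntegrableOn (fun t => C / ε * Real.exp (-(b 0 / 2) * t)) (Ioi ε) :=
    (integrableOn_exp_mul_Ioi (by linarith) ε).const_mul _
  refine Integrable.mono' hg (measurable_levyKernel a b).aestronglyMeasurable ?_
  filter_upwards [ae_restrict_mem measurableSet_Ioi] with t ht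
  have ht0 : 0 < t := hε.trans ht
  rw [Real.norm_eq_abs, abs_of_nonneg (levyKernel_nonneg ha hb ht0), levyKernel_eq ha hb ht0,
    div_mul_eq_mul_div]
  exact div_le_div₀ (by positivity) (hC t ht0.le) hε (le_of_lt ht)

theorem integrableOn_levyKernel_div_Ioi (ha : ∀ i, 0 < a i) (hb : ∀ j, 0 < b j) {ε : ℝ}
    (hε : 0 < ε) : IntegrableOn (fun t => levyKernel a b t / t) (Ioi ε) := by
  have hm := measurable_levyKernel a b
  refine Integrable.mono' ((integrableOn_levyKernel_Ioi ha hb hε).div_const ε)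
    (Measurable.aestronglyMeasurable (by fun_prop)) ?_
  filter_upwards [ae_restrict_mem measurableSet_Ioi] with t ht
  have ht0 : 0 < t := hε.trans ht
  have hk := levyKernel_nonneg ha hb ht0
  rw [Real.norm_eq_abs, abs_of_nonneg (by positivity)]
  exact div_le_div_of_nonneg_left hk hε (le_of_lt ht)

/-- Existence of the `n`-th convolution root of the law of the logarithm of the Barnes beta
distribution. -/
theorem exists_hasExpTransform_barnes (ha : ∀ i, 0 < a i) (hb : ∀ j, 0 < b j) (n : ℕ) :
    ∃ ν, HasExpTransform ν (-b 0) (fun q => Complex.exp ((n : ℂ)⁻¹ * barnesLevyExponent a b q)) := by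
  have hJ : ∀ (q : ℂ) (t : ℝ), (Complex.exp (-(t * q)) - 1 + q * t) *
      ((levyKernel a b t / t * (n : ℝ)⁻¹ : ℝ) : ℂ) = (n : ℂ)⁻¹ * levyJumpIntegrand a b q t := by
    intro q t
    rw [levyJumpIntegrand]
    push_cast
    ring
  have hE : ∀ q : ℂ, (∫ t in Ioi (0 : ℝ), (Complex.exp (-(t * q)) - 1 + q * t) *
      ((levyKernel a b t / t * (n : ℝ)⁻¹ : ℝ) : ℂ)) +
      q * (((n : ℝ)⁻¹ * ∫ t in Ioi (0 : ℝ), levyDriftIntegrand a b t : ℝ) : ℂ)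
      = (n : ℂ)⁻¹ * barnesLevyExponent a b q := by
    intro q
    simp_rw [hJ]
    rw [integral_const_mul, barnesLevyExponent, Complex.ofReal_mul, Complex.ofReal_inv,
      Complex.ofReal_natCast]
    ring
  have hm := measurable_levyKernel a b
  have h := exists_hasExpTransform_levy (σ := -b 0) (by linarith [hb 0])
    (k := fun t => levyKernel a b t / t * (n : ℝ)⁻¹) (by fun_prop)
    (fun t ht => by have := levyKernel_nonneg ha hb ht; positivity)
    (fun q hq => by
      simp_rw [hJ]
      exact (integrableOn_levyJumpIntegrand ha hb hq).const_mul _)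
    (fun ε hε => (integrableOn_levyKernel_div_Ioi ha hb hε).mul_const _)
    (fun ε hε => by
      refine IntegrableOn.congr_fun ((integrableOn_levyKernel_Ioi ha hb hε).mul_const (n : ℝ)⁻¹)
        (fun t ht => ?_) measurableSet_Ioi
      have ht0 : t ≠ 0 := (hε.trans ht).ne'
      field_simp)
    ((n : ℝ)⁻¹ * ∫ t in Ioi (0 : ℝ), levyDriftIntegrand a b t)
    (by
      simp_rw [hE]
      exact (differentiableOn_levyExponent ha hb).const_mul _)
  simp_rw [hE] at h
  exact h

theorem isInfinitelyDivisible_of_hasExpTransform_barnes (ha : ∀ i, 0 < a i) (hb : ∀ j, 0 < b j)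
    {μ : Measure ℝ}
    (h : HasExpTransform μ (-b 0) (fun q => Complex.exp (barnesLevyExponent a b q))) :
    IsInfinitelyDivisible μ := by
  intro n hn
  obtain ⟨ν, hν⟩ := exists_hasExpTransform_barnes ha hb n
  refine ⟨ν, hν.isProbabilityMeasure, ?_⟩
  refine HasExpTransform.unique (σ := -b 0) ?_ h (by linarith [hb 0])
  have e : (fun q => Complex.exp (barnesLevyExponent a b q))
      = fun q => Complex.exp ((n : ℂ)⁻¹ * barnesLevyExponent a b q) ^ n := ?_
  · rw [e]
    exact hν.convolutionPower n
  funext q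
  have : (n : ℂ) ≠ 0 := by exact_mod_cast (by omega : n ≠ 0)
  rw [← Complex.exp_nat_mul, mul_inv_cancel_left₀ this]

/-- The characteristic function of the law decays exponentially. -/
theorem exists_norm_exp_barnesLevyExponent_le (ha : ∀ i, 0 < a i) (hb : ∀ j, 0 < b j) :
    ∃ c, 0 < c ∧ ∀ u : ℝ, 1 ≤ |u| →
      ‖Complex.exp (barnesLevyExponent a b (u * Complex.I))‖ ≤ Real.exp (-(c * |u|)) := by
  obtain ⟨c₀, hc₀, hc⟩ := exists_le_regularKernel ha hb
  have hπ := Real.pi_pos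
  -- On `(0, 1/|u|]`, contained in `(0, 1]`, `1 - cos (tu) ≥ (2/π²) t² u²` and `K(t)/t ≥ c₀/t²`. The
  -- product is the constant `(2/π²) c₀ u²` on an interval of length `1/|u|`; elsewhere the
  -- integrand is nonpositive and may be dropped.
  refine ⟨2 / Real.pi ^ 2 * c₀, by positivity, fun u hu => ?_⟩
  have hu0 : 0 < |u| := by linarith
  have hq : -b 0 < ((u : ℂ) * Complex.I).re := by simpa using hb 0
  have hint := integrableOn_levyJumpIntegrand ha hb hq
  have e1 : ((u : ℂ) * Complex.I * ((∫ t in Ioi (0 : ℝ), levyDriftIntegrand a b t : ℝ) : ℂ)).re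
      = 0 := by simp
  have hre := integral_re hint
  simp only [RCLike.re_to_complex] at hre
  rw [Complex.norm_exp, Real.exp_le_exp, barnesLevyExponent, Complex.add_re, e1, add_zero, ← hre]
  have hJ : ∀ t : ℝ, (levyJumpIntegrand a b (u * Complex.I) t).re
      = (Real.cos (t * u) - 1) * (levyKernel a b t / t) := by
    intro t
    have e2 : levyJumpIntegrand a b (u * Complex.I) t
        = (Complex.exp (((-(t * u) : ℝ) : ℂ) * Complex.I) - 1 + ((u * t : ℝ) : ℂ) * Complex.I)
          * ((levyKernel a b t / t : ℝ) : ℂ) := by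
      rw [levyJumpIntegrand]
      push_cast
      rw [show -((t : ℂ) * (u * Complex.I)) = -((t : ℂ) * u) * Complex.I by ring]
      ring
    rw [e2, Complex.re_mul_ofReal, Complex.add_re, Complex.sub_re, Complex.exp_ofReal_mul_I_re]
    simp
  have hvol : ∫ t in Ioi (0 : ℝ), (Ioc 0 (1 / |u|)).indicator
      (fun _ => -(2 / Real.pi ^ 2 * u ^ 2 * c₀)) t = -(2 / Real.pi ^ 2 * c₀ * |u|) := by
    rw [setIntegral_indicator measurableSet_Ioc, inter_eq_right.2 Ioc_subset_Ioi_self,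
      setIntegral_const, Real.volume_real_Ioc_of_le (by positivity), smul_eq_mul, ← sq_abs u]
    field_simp
    ring
  rw [← hvol]
  refine integral_mono_ae hint.re ?_ ?_
  · refine IntegrableOn.integrable_indicator ?_ measurableSet_Ioc
    exact integrableOn_const (hs := by
      refine ((Measure.restrict_apply_le _ _).trans_lt ?_).ne
      simp)
  · filter_upwards [ae_restrict_mem measurableSet_Ioi] with t ht
    have ht0 : 0 < t := ht
    have hk := levyKernel_nonneg ha hb ht0
    change (levyJumpIntegrand a b (u * Complex.I) t).re ≤ _
    rw [hJ]
    by_cases hmem : t ∈ Ioc 0 (1 / |u|)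
    · rw [indicator_of_mem hmem]
      have htu : t * |u| ≤ 1 := by
        have := hmem.2
        rwa [le_div_iff₀ hu0] at this
      have ht1 : t ≤ 1 := by nlinarith
      have h1 := hc t ⟨ht0.le, ht1⟩
      have h2 : Real.cos (t * u) ≤ 1 - 2 / Real.pi ^ 2 * (t * u) ^ 2 := by
        refine Real.cos_le_one_sub_mul_cos_sq ?_
        rw [abs_mul, abs_of_pos ht0]
        linarith [Real.pi_gt_three]
      have h3 : c₀ / t ^ 2 ≤ levyKernel a b t / t := by
        rw [levyKernel_eq ha hb ht0, div_div, ← sq]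
        gcongr
      calc _ ≤ (-(2 / Real.pi ^ 2 * (t * u) ^ 2)) * (levyKernel a b t / t) :=
            mul_le_mul_of_nonneg_right (by linarith) (by positivity)
        _ ≤ (-(2 / Real.pi ^ 2 * (t * u) ^ 2)) * (c₀ / t ^ 2) :=
            mul_le_mul_of_nonpos_left h3 (neg_nonpos.2 (by positivity))
        _ = _ := by field_simp
    · rw [indicator_of_notMem hmem]
      exact mul_nonpos_of_nonpos_of_nonneg (by linarith [Real.cos_le_one (t * u)]) (by positivity)

end BarnesLaw

/-! ### Fourier inversion: absolute continuity and full support. -/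

section SmoothDensity

open Filter Topology
open scoped FourierTransform SchwartzMap ContDiff

theorem integrable_exp_neg_mul_abs {c : ℝ} (hc : 0 < c) :
    Integrable (fun x : ℝ => Real.exp (-(c * |x|))) := by
  rw [← integrableOn_univ, ← Iic_union_Ioi (a := (0 : ℝ))]
  refine IntegrableOn.union ?_ ?_
  · refine (integrableOn_exp_mul_Iic hc 0).congr_fun (fun x hx => ?_) measurableSet_Iic
    simp [abs_of_nonpos (mem_Iic.1 hx)]
  · refine (integrableOn_exp_mul_Ioi (neg_lt_zero.2 hc) 0).congr_fun (fun x hx => ?_)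
      measurableSet_Ioi
    simp [abs_of_pos (mem_Ioi.1 hx)]

/-- The Fourier inversion integral of the characteristic function of `μ`, as a function of a
complex variable. -/
noncomputable def inversionDensity (μ : Measure ℝ) (z : ℂ) : ℂ :=
  ∫ ξ : ℝ, Complex.exp (-(2 * Real.pi * ξ * z * Complex.I)) * charFun μ (2 * Real.pi * ξ)

variable {μ : Measure ℝ} [IsProbabilityMeasure μ]

theorem measurable_charFun_mul (c : ℝ) : Measurable fun ξ : ℝ => charFun μ (c * ξ) :=
  measurable_charFun.comp (measurable_const_mul c)

/-- Parseval's formula, by Fourier inversion of `f` and two applications of Fubini. It identifies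
the inversion integral as the density of `μ` when tested on Schwartz functions. -/
theorem integral_schwartz_eq (hφ : Integrable fun ξ : ℝ => charFun μ (2 * Real.pi * ξ))
    (f : 𝓢(ℝ, ℂ)) : ∫ x, f x ∂μ = ∫ x : ℝ, f x * inversionDensity μ x := by
  have hF : Integrable (𝓕 f : 𝓢(ℝ, ℂ)) := SchwartzMap.integrable _
  have hFc : Continuous (𝓕 f : 𝓢(ℝ, ℂ)) := SchwartzMap.continuous _
  have hfc : Continuous f := SchwartzMap.continuous _
  have hinv : ∀ x : ℝ, f x = ∫ ξ : ℝ, Complex.exp (2 * Real.pi * ξ * x * Complex.I) *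
      (𝓕 f : 𝓢(ℝ, ℂ)) ξ := by
    intro x
    have h : (𝓕⁻ (𝓕 f) : 𝓢(ℝ, ℂ)) x = f x := by rw [FourierTransform.fourierInv_fourier_eq]
    rw [← h, SchwartzMap.fourierInv_coe, Real.fourierInv_eq']
    refine integral_congr_ae (Eventually.of_forall fun ξ => ?_)
    simp only [smul_eq_mul, RCLike.inner_apply, conj_trivial]
    push_cast
    congr 3
    ring
  have hdir : ∀ ξ : ℝ, (𝓕 f : 𝓢(ℝ, ℂ)) ξ
      = ∫ x : ℝ, Complex.exp (-(2 * Real.pi * ξ * x * Complex.I)) * f x := by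
    intro ξ
    rw [SchwartzMap.fourier_coe, Real.fourier_real_eq_integral_exp_smul]
    refine integral_congr_ae (Eventually.of_forall fun x => ?_)
    simp only [smul_eq_mul]
    push_cast
    congr 2
    ring
  have hn : ∀ (x ξ : ℝ), ‖Complex.exp (2 * Real.pi * ξ * x * Complex.I)‖ = 1 := by
    intro x ξ
    rw [Complex.norm_exp]; simp
  have hn' : ∀ (x ξ : ℝ), ‖Complex.exp (-(2 * Real.pi * ξ * x * Complex.I))‖ = 1 := by
    intro x ξ
    rw [Complex.norm_exp]; simp
  calc ∫ x, f x ∂μ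
      = ∫ x : ℝ, (∫ ξ : ℝ, Complex.exp (2 * Real.pi * ξ * x * Complex.I) *
          (𝓕 f : 𝓢(ℝ, ℂ)) ξ) ∂μ := integral_congr_ae (Eventually.of_forall hinv)
    _ = ∫ ξ : ℝ, ∫ x : ℝ, Complex.exp (2 * Real.pi * ξ * x * Complex.I) *
          (𝓕 f : 𝓢(ℝ, ℂ)) ξ ∂μ := by
        refine integral_integral_swap ?_
        refine (hF.norm.comp_snd μ).mono' ?_ (Eventually.of_forall fun p => ?_)
        · refine Continuous.aestronglyMeasurable ?_
          unfold Function.uncurry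
          fun_prop
        · simp only [Function.uncurry, norm_mul, hn, one_mul, le_refl]
    _ = ∫ ξ : ℝ, (𝓕 f : 𝓢(ℝ, ℂ)) ξ * charFun μ (2 * Real.pi * ξ) := by
        refine integral_congr_ae (Eventually.of_forall fun ξ => ?_)
        simp only
        rw [integral_mul_const, mul_comm, charFun_apply_real]
        push_cast
        rfl
    _ = ∫ ξ : ℝ, ∫ x : ℝ, Complex.exp (-(2 * Real.pi * ξ * x * Complex.I)) * f x *
          charFun μ (2 * Real.pi * ξ) := by
        refine integral_congr_ae (Eventually.of_forall fun ξ => ?_)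
        simp only
        rw [hdir, integral_mul_const]
    _ = ∫ x : ℝ, ∫ ξ : ℝ, Complex.exp (-(2 * Real.pi * ξ * x * Complex.I)) * f x *
          charFun μ (2 * Real.pi * ξ) := by
        refine integral_integral_swap ?_
        refine (hφ.norm.mul_prod (SchwartzMap.integrable f (μ := volume)).norm).mono' ?_
          (Eventually.of_forall fun p => ?_)
        · have h1 := (measurable_charFun_mul (μ := μ) (2 * Real.pi)).comp
            (measurable_fst : Measurable (Prod.fst : ℝ × ℝ → ℝ))
          refine Measurable.aestronglyMeasurable (Measurable.mul ?_ h1)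
          exact Continuous.measurable (by fun_prop)
        · simp only [Function.uncurry, norm_mul, hn', one_mul]
          rw [mul_comm]
    _ = ∫ x : ℝ, f x * inversionDensity μ x := by
        refine integral_congr_ae (Eventually.of_forall fun x => ?_)
        simp only
        rw [inversionDensity, ← integral_const_mul]
        congr 1
        funext ξ
        ring

theorem measure_le_of_norm_inversionDensity_le
    (hφ : Integrable fun ξ : ℝ => charFun μ (2 * Real.pi * ξ)) {D : ℝ} (hD0 : 0 ≤ D)
    (hD : ∀ x : ℝ, ‖inversionDensity μ x‖ ≤ D) {K U : Set ℝ} (hK : IsCompact K) (hU : IsOpen U)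
    (hKU : K ⊆ U) : μ K ≤ ENNReal.ofReal D * volume U := by
  -- A smooth bump equal to `1` on `K` and supported in a compact set inside `U` is a Schwartz
  -- function lying between the two indicators.
  obtain ⟨t, ht, hKt, htU⟩ := exists_compact_between hK hU hKU
  obtain ⟨f, hf1, hf0, hf01⟩ := exists_contMDiffMap_one_nhds_of_subset_interior
    (modelWithCornersSelf ℝ ℝ) (n := (⊤ : ℕ∞)) hK.isClosed hKt
  have hfs : HasCompactSupport (fun x => (f x : ℂ)) :=
    HasCompactSupport.intro ht fun x hx => by simp [hf0 x hx]
  have hfd : ContDiff ℝ ∞ (fun x => (f x : ℂ)) :=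
    Complex.ofRealCLM.contDiff.comp f.contMDiff.contDiff
  have hfc : Continuous f := f.contMDiff.continuous
  have key := integral_schwartz_eq hφ (hfs.toSchwartzMap hfd)
  have hfi : Integrable f volume :=
    hfc.integrable_of_hasCompactSupport (HasCompactSupport.intro ht fun x hx => hf0 x hx)
  have hfiμ : Integrable f μ :=
    hfc.integrable_of_hasCompactSupport (HasCompactSupport.intro ht fun x hx => hf0 x hx)
  have h1 : μ.real K ≤ ∫ x, f x ∂μ := by
    rw [← integral_indicator_one hK.measurableSet]
    refine integral_mono ((integrable_const (1 : ℝ)).indicator hK.measurableSet) hfiμ fun x => ?_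
    by_cases hx : x ∈ K
    · simpa [hx] using (hf1.self_of_nhdsSet x hx).ge
    · simpa [hx] using (hf01 x).1
  have h2 : ∫ x, f x ∂volume ≤ volume.real t := by
    rw [← integral_indicator_one ht.measurableSet]
    refine integral_mono hfi
      (IntegrableOn.integrable_indicator (integrableOn_const ht.measure_lt_top.ne)
        ht.measurableSet) fun x => ?_
    by_cases hx : x ∈ t
    · simpa [hx] using (hf01 x).2
    · simp [hx, hf0 x hx]
  have h3 : ∫ x, f x ∂μ ≤ D * ∫ x, f x := by
    have e1 : ‖∫ x, (f x : ℂ) ∂μ‖ = ∫ x, f x ∂μ := by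
      rw [integral_complex_ofReal, Complex.norm_real, Real.norm_eq_abs,
        abs_of_nonneg (integral_nonneg fun x => (hf01 x).1)]
    rw [← e1, ← integral_const_mul]
    have e2 : ∫ x, (f x : ℂ) ∂μ = ∫ x : ℝ, (f x : ℂ) * inversionDensity μ x := key
    rw [e2]
    refine norm_integral_le_of_norm_le (hfi.const_mul D) (Eventually.of_forall fun x => ?_)
    rw [norm_mul, Complex.norm_real, Real.norm_eq_abs, abs_of_nonneg (hf01 x).1, mul_comm]
    exact mul_le_mul_of_nonneg_right (hD x) (hf01 x).1
  calc μ K = ENNReal.ofReal (μ.real K) := by simp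
    _ ≤ ENNReal.ofReal (D * volume.real t) :=
        ENNReal.ofReal_le_ofReal ((h1.trans h3).trans (mul_le_mul_of_nonneg_left h2 hD0))
    _ = ENNReal.ofReal D * volume t := by
        rw [ENNReal.ofReal_mul hD0, ofReal_measureReal ht.measure_lt_top.ne]
    _ ≤ _ := by gcongr

/-- A distribution whose characteristic function is integrable is absolutely continuous. -/
theorem absolutelyContinuous_of_integrable_charFun
    (hφ : Integrable fun ξ : ℝ => charFun μ (2 * Real.pi * ξ)) : μ ≪ volume := by
  set D := ∫ ξ : ℝ, ‖charFun μ (2 * Real.pi * ξ)‖ with hDdef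
  have hD : ∀ x : ℝ, ‖inversionDensity μ x‖ ≤ D := fun x => by
    refine norm_integral_le_of_norm_le hφ.norm (Eventually.of_forall fun ξ => ?_)
    rw [norm_mul, Complex.norm_exp]
    simp
  have hD0 : 0 ≤ D := (norm_nonneg _).trans (hD 0)
  refine Measure.AbsolutelyContinuous.mk fun s hs hs0 => ?_
  rw [hs.measure_eq_iSup_isCompact]
  simp only [ENNReal.iSup_eq_zero]
  intro K hKs hK
  have hK0 : volume K = 0 := measure_mono_null hKs hs0
  refine le_antisymm (ENNReal.le_of_forall_pos_le_add fun ε hε _ => ?_) bot_le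
  have hδ : (ε : ENNReal) / (ENNReal.ofReal D + 1) ≠ 0 := by
    simp [hε.ne']
  obtain ⟨U, hKU, hU, hUlt⟩ := K.exists_isOpen_lt_add (μ := volume) (by simp [hK0]) hδ
  rw [hK0, zero_add] at hUlt
  rw [zero_add]
  calc μ K ≤ ENNReal.ofReal D * volume U :=
        measure_le_of_norm_inversionDensity_le hφ hD0 hD hK hU hKU
    _ ≤ (ENNReal.ofReal D + 1) * (ε / (ENNReal.ofReal D + 1)) := by
        gcongr
        exact le_self_add
    _ ≤ ε := ENNReal.mul_div_le

theorem differentiableOn_inversionDensity {C c : ℝ}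
    (h : ∀ u : ℝ, ‖charFun μ u‖ ≤ C * Real.exp (-(c * |u|))) :
    DifferentiableOn ℂ (inversionDensity μ) {z | |z.im| < c} := by
  have hπ := Real.pi_pos
  have hopen : IsOpen {z : ℂ | |z.im| < c} :=
    isOpen_lt (continuous_abs.comp Complex.continuous_im) continuous_const
  refine differentiableOn_integral_of_locally_dominated hopen (fun z _ => ?_)
    (Eventually.of_forall fun ξ => by fun_prop) fun z₀ hz₀ => ?_
  · refine (Measurable.mul ?_ (measurable_charFun_mul _)).aestronglyMeasurable
    exact Continuous.measurable (by fun_prop)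
  -- Half the distance to the boundary of the strip. On the ball `|im z| ≤ c - r`, so the factor
  -- `e^{2π|ξ|(c-r)}` still leaves the decay `e^{-2πr|ξ|}`.
  · set r := (c - |z₀.im|) / 2 with hr
    have hz₀ : |z₀.im| < c := hz₀
    have hr0 : 0 < r := by rw [hr]; linarith
    refine ⟨r, hr0, fun ξ => C * Real.exp (-(2 * Real.pi * r * |ξ|)),
      (integrable_exp_neg_mul_abs (by positivity)).const_mul _,
      Eventually.of_forall fun ξ z hz => ?_⟩
    have hz : ‖z - z₀‖ < r := by rwa [Metric.mem_ball, dist_eq_norm] at hz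
    have him : |z.im| ≤ c - r := by
      have h1 := Complex.abs_im_le_norm (z - z₀)
      rw [Complex.sub_im] at h1
      have h2 := abs_sub_abs_le_abs_sub z.im z₀.im
      rw [hr] at hz ⊢
      linarith
    have h1 : ‖Complex.exp (-(2 * Real.pi * ξ * z * Complex.I))‖
        ≤ Real.exp (2 * Real.pi * |ξ| * (c - r)) := by
      rw [Complex.norm_exp]
      apply Real.exp_le_exp.2
      have e : (-(2 * Real.pi * ξ * z * Complex.I)).re = 2 * Real.pi * (ξ * z.im) := by
        simp; ring
      rw [e, mul_assoc (2 * Real.pi) |ξ|]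
      refine mul_le_mul_of_nonneg_left ?_ (mul_pos two_pos hπ).le
      refine (le_abs_self _).trans ?_
      rw [abs_mul]
      exact mul_le_mul_of_nonneg_left him (abs_nonneg _)
    have h2 := h (2 * Real.pi * ξ)
    rw [norm_mul]
    calc _ ≤ Real.exp (2 * Real.pi * |ξ| * (c - r)) *
          (C * Real.exp (-(c * |2 * Real.pi * ξ|))) :=
          mul_le_mul h1 h2 (norm_nonneg _) (Real.exp_pos _).le
      _ = C * Real.exp (-(2 * Real.pi * r * |ξ|)) := by
          rw [abs_mul, abs_of_pos (by positivity : 0 < 2 * Real.pi), mul_left_comm, ← Real.exp_add]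
          congr 2; ring

theorem integrable_charFun_of_norm_le {C c : ℝ} (hc : 0 < c)
    (h : ∀ u : ℝ, ‖charFun μ u‖ ≤ C * Real.exp (-(c * |u|))) :
    Integrable fun ξ : ℝ => charFun μ (2 * Real.pi * ξ) := by
  have hπ := Real.pi_pos
  refine ((integrable_exp_neg_mul_abs (c := c * (2 * Real.pi)) (by positivity)).const_mul C).mono'
    (measurable_charFun_mul _).aestronglyMeasurable (Eventually.of_forall fun ξ => ?_)
  refine (h _).trans (le_of_eq ?_)
  rw [abs_mul, abs_of_pos (by positivity : 0 < 2 * Real.pi), mul_assoc c]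

/-- A distribution whose characteristic function decays exponentially has an analytic density, so
it charges every interval. -/
theorem support_eq_univ_of_norm_charFun_le {C c : ℝ} (hc : 0 < c)
    (h : ∀ u : ℝ, ‖charFun μ u‖ ≤ C * Real.exp (-(c * |u|))) : μ.support = univ := by
  have hφ := integrable_charFun_of_norm_le hc h
  have hdiff := differentiableOn_inversionDensity h
  have hopen : IsOpen {z : ℂ | |z.im| < c} :=
    isOpen_lt (continuous_abs.comp Complex.continuous_im) continuous_const
  have hreal : ∀ x : ℝ, (x : ℂ) ∈ {z : ℂ | |z.im| < c} := fun x => by simpa using hc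
  have hcont : Continuous fun x : ℝ => inversionDensity μ x := by
    have := hdiff.continuousOn.comp_continuous Complex.continuous_ofReal hreal
    exact this
  by_contra hne
  obtain ⟨x₀, hx₀⟩ := (ne_univ_iff_exists_notMem _).1 hne
  obtain ⟨W, hW, hμW⟩ := Measure.notMem_support_iff_exists.1 hx₀
  obtain ⟨V, hVW, hV, hx₀V⟩ := mem_nhds_iff.1 hW
  have hμV : μ V = 0 := measure_mono_null hVW hμW
  -- Tested against smooth functions supported in the `μ`-null open set `V`, the density integrates
  -- to zero, so it vanishes almost everywhere on `V`, and by continuity everywhere on `V`.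
  have hae : ∀ᵐ x ∂(volume : Measure ℝ), x ∈ V → inversionDensity μ x = 0 := by
    refine hV.ae_eq_zero_of_integral_contDiff_smul_eq_zero
      (hcont.locallyIntegrable.locallyIntegrableOn V) fun g hg hgs hgV => ?_
    have hfs : HasCompactSupport (fun x => (g x : ℂ)) := 
      HasCompactSupport.comp_left (g := fun y : ℝ => (y : ℂ)) hgs (by simp)
    have hfd : ContDiff ℝ ∞ (fun x => (g x : ℂ)) := Complex.ofRealCLM.contDiff.comp hg
    have key : ∫ x, (g x : ℂ) ∂μ = ∫ x : ℝ, (g x : ℂ) * inversionDensity μ x :=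
      integral_schwartz_eq hφ (hfs.toSchwartzMap hfd)
    simp only [Complex.real_smul]
    rw [← key]
    refine integral_eq_zero_of_ae ?_
    have hnull : ∀ᵐ x ∂μ, x ∉ V := measure_eq_zero_iff_ae_notMem.1 hμV
    filter_upwards [hnull] with x hx
    have : g x = 0 := image_eq_zero_of_notMem_tsupport fun h => hx (hgV h)
    simp [this]
  have hzeroV : ∀ x ∈ V, inversionDensity μ x = 0 := by
    have ho : IsOpen (V ∩ {x : ℝ | inversionDensity μ x ≠ 0}) :=
      hV.inter (isOpen_ne_fun hcont continuous_const)
    have hn : volume (V ∩ {x : ℝ | inversionDensity μ x ≠ 0}) = 0 := by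
      refine measure_mono_null (fun x hx => ?_) hae
      exact fun h' => hx.2 (h' hx.1)
    have := ho.eq_empty_of_measure_zero hn
    intro x hx
    by_contra hx0
    have hmem : x ∈ V ∩ {x : ℝ | inversionDensity μ x ≠ 0} := ⟨hx, hx0⟩
    rw [this] at hmem
    exact hmem
  have hpre : IsPreconnected {z : ℂ | |z.im| < c} := by
    have : {z : ℂ | |z.im| < c} = Complex.imCLM ⁻¹' (Ioo (-c) c) := by
      ext z; simp [abs_lt]
    rw [this]
    exact ((convex_Ioo (-c) c).is_linear_preimage Complex.imCLM.isLinear).isPreconnected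
  have hlim : Tendsto (fun n : ℕ => ((x₀ + 1 / (n + 1 : ℝ) : ℝ) : ℂ)) atTop (𝓝[≠] (x₀ : ℂ)) := by
    rw [tendsto_nhdsWithin_iff]
    constructor
    · have := (tendsto_one_div_add_atTop_nhds_zero_nat (𝕜 := ℝ)).const_add x₀
      rw [add_zero] at this
      exact (Complex.continuous_ofReal.tendsto _).comp this
    · refine Eventually.of_forall fun n => ?_
      simp only [mem_compl_iff, mem_singleton_iff]
      norm_cast
      have : (0 : ℝ) < 1 / (n + 1 : ℝ) := by positivity
      push_cast at this ⊢
      linarith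
  have hev : ∀ᶠ n : ℕ in atTop, x₀ + 1 / (n + 1 : ℝ) ∈ V := by
    have := (tendsto_one_div_add_atTop_nhds_zero_nat (𝕜 := ℝ)).const_add x₀
    rw [add_zero] at this
    exact this.eventually_mem (hV.mem_nhds hx₀V)
  -- Vanishing on `V` spreads over the whole strip by the identity theorem. The density bound with
  -- `D = 0` then makes `μ` the zero measure, a contradiction.
  have hzero : ∀ x : ℝ, inversionDensity μ x = 0 := by
    intro x
    refine (hdiff.analyticOnNhd hopen).eqOn_of_preconnected_of_frequently_eq
      (analyticOnNhd_const (v := (0 : ℂ))) hpre (hreal x₀) ?_ (hreal x)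
    exact hlim.frequently (hev.frequently.mono fun n hn => hzeroV _ hn)
  have huniv : μ univ = 0 := by
    rw [MeasurableSet.univ.measure_eq_iSup_isCompact]
    simp only [ENNReal.iSup_eq_zero]
    intro K _ hK
    have := measure_le_of_norm_inversionDensity_le hφ le_rfl (fun x => by rw [hzero x]; simp)
      hK isOpen_univ (subset_univ K)
    simpa using this
  rw [measure_univ] at huniv
  exact one_ne_zero huniv

end SmoothDensity

/-! ### Mellin transforms as exponential transforms of the logarithm. -/

section MellinTransform

open Filter Topology

theorem HasMellinTransform.ae_pos {β : Measure ℝ} {σ : ℝ} {η : ℂ → ℂ}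
    (h : HasMellinTransform β σ η) : ∀ᵐ x ∂β, 0 < x := by
  filter_upwards [measure_eq_zero_iff_ae_notMem.1 h.measure_Iic_zero] with x hx
  exact not_le.1 hx

theorem Complex.exp_mul_log_ofReal {x : ℝ} (hx : 0 < x) (q : ℂ) :
    Complex.exp (q * (Real.log x : ℝ)) = (x : ℂ) ^ q := by
  rw [Complex.cpow_def_of_ne_zero (by exact_mod_cast hx.ne'), Complex.ofReal_log hx.le, mul_comm]

/-- The Mellin transform of `β` is the exponential transform of the law of the logarithm. -/
theorem HasMellinTransform.hasExpTransform_map_log {β : Measure ℝ} {σ : ℝ} {η : ℂ → ℂ}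
    (h : HasMellinTransform β σ η) : HasExpTransform (β.map Real.log) σ η := by
  have := h.isProbabilityMeasure
  have hae : ∀ q : ℂ, (fun x : ℝ => Complex.exp (q * (Real.log x : ℝ))) =ᵐ[β]
      fun x : ℝ => (x : ℂ) ^ q := fun q => by
    filter_upwards [h.ae_pos] with x hx using Complex.exp_mul_log_ofReal hx q
  have hm : ∀ q : ℂ, AEStronglyMeasurable (fun y : ℝ => Complex.exp (q * y))
      (β.map Real.log) := fun q => Continuous.aestronglyMeasurable (by fun_prop)
  refine ⟨Measure.isProbabilityMeasure_map Real.measurable_log.aemeasurable, fun q hq => ?_,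
    fun q hq => ?_⟩
  · rw [integrable_map_measure (hm q) Real.measurable_log.aemeasurable]
    exact (h.integrable q hq).congr (hae q).symm
  · rw [integral_map Real.measurable_log.aemeasurable (hm q), integral_congr_ae (hae q),
      h.integral_eq q hq]

theorem HasExpTransform.hasMellinTransform_map_exp {μ : Measure ℝ} {σ : ℝ} {φ : ℂ → ℂ}
    (h : HasExpTransform μ σ φ) : HasMellinTransform (μ.map Real.exp) σ φ := by
  have := h.isProbabilityMeasure
  have hpow : ∀ (q : ℂ) (y : ℝ), ((Real.exp y : ℝ) : ℂ) ^ q = Complex.exp (q * y) := fun q y => by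
    rw [← Complex.exp_mul_log_ofReal (Real.exp_pos y), Real.log_exp]
  have hm : ∀ q : ℂ, AEStronglyMeasurable (fun x : ℝ => (x : ℂ) ^ q) (μ.map Real.exp) := fun q =>
    (Complex.measurable_ofReal.pow_const q).aestronglyMeasurable
  refine ⟨Measure.isProbabilityMeasure_map Real.measurable_exp.aemeasurable, ?_, fun q hq => ?_,
    fun q hq => ?_⟩
  · rw [Measure.map_apply Real.measurable_exp measurableSet_Iic]
    have : Real.exp ⁻¹' Iic 0 = ∅ := by
      ext y; simp [Real.exp_pos y]
    rw [this, measure_empty]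
  · rw [integrable_map_measure (hm q) Real.measurable_exp.aemeasurable]
    simpa only [Function.comp_def, hpow] using h.integrable q hq
  · rw [integral_map Real.measurable_exp.aemeasurable (hm q)]
    simpa only [hpow] using h.integral_eq q hq

/-- Nothing is lost by passing to the logarithm, since `β` does not charge `(-∞, 0]`; uniqueness
therefore transfers from laws on the line. -/
theorem HasMellinTransform.map_exp_map_log {β : Measure ℝ} {σ : ℝ} {η : ℂ → ℂ}
    (h : HasMellinTransform β σ η) : (β.map Real.log).map Real.exp = β := by
  rw [Measure.map_map Real.measurable_exp Real.measurable_log]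
  conv_rhs => rw [← Measure.map_id (μ := β)]
  refine Measure.map_congr ?_
  filter_upwards [h.ae_pos] with x hx using Real.exp_log hx

theorem HasMellinTransform.unique {β β' : Measure ℝ} {σ : ℝ} {η : ℂ → ℂ}
    (h : HasMellinTransform β σ η) (h' : HasMellinTransform β' σ η) (hσ : σ < 0) : β = β' := by
  rw [← h.map_exp_map_log, ← h'.map_exp_map_log,
    h.hasExpTransform_map_log.unique h'.hasExpTransform_map_log hσ]

theorem HasMellinTransform.congr {β : Measure ℝ} {σ : ℝ} {η η' : ℂ → ℂ}
    (h : HasMellinTransform β σ η) (he : ∀ q : ℂ, σ < q.re → η q = η' q) :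
    HasMellinTransform β σ η' :=
  ⟨h.isProbabilityMeasure, h.measure_Iic_zero, h.integrable,
    fun q hq => (h.integral_eq q hq).trans (he q hq)⟩

theorem HasMellinTransform.map_rpow {β : Measure ℝ} {σ : ℝ} {η : ℂ → ℂ}
    (h : HasMellinTransform β σ η) {κ : ℝ} (hκ : 0 < κ) :
    HasMellinTransform (β.map fun x => x ^ κ) (σ / κ) (fun q => η (κ * q)) := by
  have := h.isProbabilityMeasure
  have hr : Measurable fun x : ℝ => x ^ κ := measurable_id.pow_const κ
  have hm : ∀ q : ℂ, AEStronglyMeasurable (fun x : ℝ => (x : ℂ) ^ q) (β.map fun x => x ^ κ) :=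
    fun q => (Complex.measurable_ofReal.pow_const q).aestronglyMeasurable
  have hae : ∀ q : ℂ, (fun x : ℝ => ((x ^ κ : ℝ) : ℂ) ^ q) =ᵐ[β]
      fun x : ℝ => (x : ℂ) ^ (κ * q) := fun q => by
    filter_upwards [h.ae_pos] with x hx
    rw [← Complex.exp_mul_log_ofReal (Real.rpow_pos_of_pos hx κ),
      ← Complex.exp_mul_log_ofReal hx, Real.log_rpow hx]
    push_cast
    congr 1; ring
  have hre : ∀ q : ℂ, σ / κ < q.re → σ < (κ * q).re := fun q hq => by
    rw [div_lt_iff₀ hκ] at hq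
    simpa [mul_comm] using hq
  refine ⟨Measure.isProbabilityMeasure_map hr.aemeasurable, ?_, fun q hq => ?_, fun q hq => ?_⟩
  · rw [Measure.map_apply hr measurableSet_Iic, measure_eq_zero_iff_ae_notMem]
    filter_upwards [h.ae_pos] with x hx
    simpa using Real.rpow_pos_of_pos hx κ
  · rw [integrable_map_measure (hm q) hr.aemeasurable]
    exact (h.integrable _ (hre q hq)).congr (hae q).symm
  · rw [integral_map hr.aemeasurable (hm q), integral_congr_ae (hae q), h.integral_eq _ (hre q hq)]

theorem HasMellinTransform.map_const_mul {β : Measure ℝ} {σ : ℝ} {η : ℂ → ℂ}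
    (h : HasMellinTransform β σ η) {s : ℝ} (hs : 0 < s) :
    HasMellinTransform (β.map fun x => s * x) σ (fun q => (s : ℂ) ^ q * η q) := by
  have := h.isProbabilityMeasure
  have hr : Measurable fun x : ℝ => s * x := measurable_const_mul s
  have hm : ∀ q : ℂ, AEStronglyMeasurable (fun x : ℝ => (x : ℂ) ^ q) (β.map fun x => s * x) :=
    fun q => (Complex.measurable_ofReal.pow_const q).aestronglyMeasurable
  have hae : ∀ q : ℂ, (fun x : ℝ => ((s * x : ℝ) : ℂ) ^ q) =ᵐ[β]
      fun x : ℝ => (s : ℂ) ^ q * (x : ℂ) ^ q := fun q => by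
    filter_upwards [h.ae_pos] with x hx
    rw [Complex.ofReal_mul, Complex.mul_cpow_ofReal_nonneg hs.le hx.le]
  refine ⟨Measure.isProbabilityMeasure_map hr.aemeasurable, ?_, fun q hq => ?_, fun q hq => ?_⟩
  · rw [Measure.map_apply hr measurableSet_Iic, measure_eq_zero_iff_ae_notMem]
    filter_upwards [h.ae_pos] with x hx
    simpa using mul_pos hs hx
  · rw [integrable_map_measure (hm q) hr.aemeasurable]
    exact ((h.integrable q hq).const_mul _).congr (hae q).symm
  · rw [integral_map hr.aemeasurable (hm q), integral_congr_ae (hae q), integral_const_mul,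
      h.integral_eq q hq]

/-- Integer moments are values of the Mellin transform. -/
theorem HasMellinTransform.zpow_moment {β : Measure ℝ} {σ : ℝ} {η : ℂ → ℂ}
    (h : HasMellinTransform β σ η) {n : ℤ} (hn : σ < n) :
    Integrable (fun x : ℝ => x ^ n) β ∧ ((∫ x : ℝ, x ^ n ∂β : ℝ) : ℂ) = η n := by
  have hre : σ < (n : ℂ).re := by simpa using hn
  have he : ∀ x : ℝ, (x : ℂ) ^ (n : ℂ) = ((x ^ n : ℝ) : ℂ) := fun x => by
    rw [Complex.cpow_intCast]; push_cast; rfl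
  have h1 := h.integrable _ hre
  have h2 := h.integral_eq _ hre
  simp only [he] at h1 h2
  exact ⟨h1.re, by rw [← h2, integral_complex_ofReal]⟩

end MellinTransform

/-! ### The Barnes beta distribution. -/

section BarnesBeta

variable {N : ℕ} {a b : Fin (N + 1) → ℝ}

theorem exists_hasMellinTransform_barnesEta (ha : ∀ i, 0 < a i) (hb : ∀ j, 0 < b j) :
    ∃ β : Measure ℝ, HasMellinTransform β (-b 0) (barnesEta a b) := by
  -- The case `n = 1` of the convolution roots is the law of the logarithm itself.
  obtain ⟨μ, hμ⟩ := exists_hasExpTransform_barnes ha hb 1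
  refine ⟨μ.map Real.exp, hμ.hasMellinTransform_map_exp.congr fun q hq => ?_⟩
  rw [barnesEta_eq_exp ha hb hq, Nat.cast_one, inv_one, one_mul]
  rfl

theorem HasMellinTransform.hasExpTransform_barnesLevyExponent (ha : ∀ i, 0 < a i)
    (hb : ∀ j, 0 < b j) {β : Measure ℝ} (h : HasMellinTransform β (-b 0) (barnesEta a b)) :
    HasExpTransform (β.map Real.log) (-b 0) (fun q => Complex.exp (barnesLevyExponent a b q)) :=
  (h.congr fun _ hq => barnesEta_eq_exp ha hb hq).hasExpTransform_map_log

theorem exists_norm_charFun_map_log_le (ha : ∀ i, 0 < a i) (hb : ∀ j, 0 < b j) {β : Measure ℝ}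
    (h : HasMellinTransform β (-b 0) (barnesEta a b)) :
    ∃ C c : ℝ, 0 < c ∧ ∀ u : ℝ, ‖charFun (β.map Real.log) u‖ ≤ C * Real.exp (-(c * |u|)) := by
  have hexp := h.hasExpTransform_barnesLevyExponent ha hb
  have := hexp.isProbabilityMeasure
  obtain ⟨c, hc, hle⟩ := exists_norm_exp_barnesLevyExponent_le ha hb
  -- The constant `e^c` covers `|u| ≤ 1`, where the trivial bound `1 ≤ e^{c - c|u|}` suffices.
  refine ⟨Real.exp c, c, hc, fun u => ?_⟩
  rcases le_total 1 |u| with hu | hu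
  · rw [hexp.charFun_eq (neg_lt_zero.2 (hb 0))]
    exact (hle u hu).trans (le_mul_of_one_le_left (Real.exp_pos _).le (Real.one_le_exp hc.le))
  · refine (norm_charFun_le_one u).trans ?_
    rw [← Real.exp_add]
    refine Real.one_le_exp ?_
    have := mul_le_mul_of_nonneg_left hu hc.le
    linarith

/-- Both laws have the Mellin transform `κ^{rq} η(q)` for `re q > -b 0`, so uniqueness applies. -/
theorem HasMellinTransform.map_rpow_eq_map_const_mul (ha : ∀ i, 0 < a i) (hb : ∀ j, 0 < b j)
    {β β' : Measure ℝ} (h : HasMellinTransform β (-b 0) (barnesEta a b)) {κ : ℝ} (hκ : 0 < κ)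
    (h' : HasMellinTransform β' (-(κ * b 0))
      (barnesEta (fun i => κ * a i) (fun j => κ * b j))) :
    β'.map (fun x : ℝ => x ^ κ) = β.map (fun x : ℝ => κ ^ barnesRatio a b * x) := by
  have h1 := h'.map_rpow hκ
  rw [neg_div, mul_div_cancel_left₀ _ hκ.ne'] at h1
  have hs : 0 < κ ^ barnesRatio a b := Real.rpow_pos_of_pos hκ _
  refine (h1.congr fun q hq => ?_).unique (h.map_const_mul hs) (neg_lt_zero.2 (hb 0))
  rw [barnesEta_mul ha hb hκ hq, ← Complex.exp_mul_log_ofReal hs, Real.log_rpow hκ]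
  push_cast
  congr 2; ring

end BarnesBeta

/-! ### Assembly of the theorem. -/

theorem theorem3p1 (N : ℕ) (a b : Fin (N + 1) → ℝ) (ha : ∀ i, 0 < a i) (hb : ∀ j, 0 < b j) :
    -- existence (and uniqueness) of the distribution with Mellin transform `η_{M,M-1}`, `M = N + 1`
    (∃! β : Measure ℝ, HasMellinTransform β (-b 0) (barnesEta a b)) ∧
    -- functional equation on `ℂ \ (-∞, -b_0]`
    (∀ (i : Fin (N + 1)) (q : ℂ), q + b 0 ∈ Complex.slitPlane →
      barnesEta a b (q + a i) = barnesEta a b q *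
        Complex.exp (-alternatingShift (logBarnesGamma (i.removeNth a)) b q)) ∧
    ∀ β : Measure ℝ, HasMellinTransform β (-b 0) (barnesEta a b) →
      -- the law of the logarithm
      IsInfinitelyDivisible (β.map Real.log) ∧
      β.map Real.log ≪ volume ∧
      (β.map Real.log).support = univ ∧
      -- Levy-Khinchine decomposition
      IntegrableOn (levyDriftIntegrand a b) (Ioi 0) ∧
      (∀ q : ℂ, -b 0 < q.re →
        IntegrableOn (levyJumpIntegrand a b q) (Ioi 0) ∧
        Integrable (fun y : ℝ => Complex.exp (q * y)) (β.map Real.log) ∧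
        ∫ y : ℝ, Complex.exp (q * y) ∂(β.map Real.log) =
          Complex.exp ((∫ t in Ioi (0 : ℝ), levyJumpIntegrand a b q t) +
            q * ((∫ t in Ioi (0 : ℝ), levyDriftIntegrand a b t : ℝ) : ℂ))) ∧
      -- moments
      (∀ i : Fin (N + 1), a i = 1 → ∀ k : ℕ,
        Integrable (fun x : ℝ => x ^ k) β ∧
        ((∫ x : ℝ, x ^ k ∂β : ℝ) : ℂ) =
          Complex.exp (-∑ l ∈ Finset.range k,
            alternatingShift (logBarnesGamma (i.removeNth a)) b (l : ℂ))) ∧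
      (∀ i : Fin (N + 1), a i = 1 → ∀ k : ℕ, (k : ℝ) < b 0 →
        Integrable (fun x : ℝ => x ^ (-(k : ℤ))) β ∧
        ((∫ x : ℝ, x ^ (-(k : ℤ)) ∂β : ℝ) : ℂ) =
          Complex.exp (∑ l ∈ Finset.range k,
            alternatingShift (logBarnesGamma (i.removeNth a)) b (-((l : ℂ) + 1)))) ∧
      -- scaling
      (∀ κ : ℝ, 0 < κ → ∀ β' : Measure ℝ,
        HasMellinTransform β' (-(κ * b 0))
          (barnesEta (fun i => κ * a i) (fun j => κ * b j)) →
        β'.map (fun x : ℝ => x ^ κ) = β.map (fun x : ℝ => κ ^ barnesRatio a b * x)) := by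
  refine ⟨?_, fun i q hq => barnesEta_add ha hb i hq, fun β h => ?_⟩
  · obtain ⟨β, hβ⟩ := exists_hasMellinTransform_barnesEta ha hb
    exact ⟨β, hβ, fun β' h' => h'.unique hβ (neg_lt_zero.2 (hb 0))⟩
  have hexp := h.hasExpTransform_barnesLevyExponent ha hb
  have := hexp.isProbabilityMeasure
  obtain ⟨C, c, hc, hle⟩ := exists_norm_charFun_map_log_le ha hb h
  refine ⟨isInfinitelyDivisible_of_hasExpTransform_barnes ha hb hexp,
    absolutelyContinuous_of_integrable_charFun (integrable_charFun_of_norm_le hc hle),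
    support_eq_univ_of_norm_charFun_le hc hle, integrableOn_levyDriftIntegrand ha hb,
    fun q hq => ⟨integrableOn_levyJumpIntegrand ha hb hq, hexp.integrable q hq,
      hexp.integral_eq q hq⟩, fun i hi k => ?_, fun i hi k hk => ?_,
    fun κ hκ β' h' => h.map_rpow_eq_map_const_mul ha hb hκ h'⟩
  · have hk : -b 0 < ((k : ℤ) : ℝ) := by
      have := hb 0
      have : (0 : ℝ) ≤ k := Nat.cast_nonneg k
      push_cast
      linarith
    have hmom := h.zpow_moment hk
    simp only [zpow_natCast, Int.cast_natCast] at hmom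
    rwa [barnesEta_natCast ha hb hi] at hmom
  · have hk' : -b 0 < ((-(k : ℤ) : ℤ) : ℝ) := by
      push_cast
      linarith
    have hmom := h.zpow_moment hk'
    rw [Int.cast_neg, Int.cast_natCast, barnesEta_neg_natCast ha hb hi k hk] at hmom
    exact hmom
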